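/- Let $d\ge 1$ be an integer and let $G$ be a locally compact group with neutral element $e$. Let $\mathbb S^d$ be the unit sphere of $\mathbb R^{d+1}$ and $\theta(\xi,\eta)=\arccos(\xi\cdot\eta)$ for $\xi,\eta\in\mathbb S^d$. Let $\mathcal P(G)$ be the set of continuous functions $\varphi:G\to\mathbb C$ such that for all $m\in\mathbb N$ and $u_1,\dots,u_m\in G$ the matrix $[\varphi(u_k^{-1}u_l)]_{k,l=1}^m$ is (hermitian) positive semidefinite, and let $\mathcal P(\mathbb S^d,G)$ be the set of continuous functions $f:[-1,1]\times G\to\mathbb C$ such that for all $m\in\mathbb N$ and $(\xi_1,u_1),\dots,(\xi_m,u_m)\in\mathbb S^d\times G$ the matrix $[f(\cos\theta(\xi_k,\xi_l),u_k^{-1}u_l)]_{k,l=1}^m$ is (hermitian) positive semidefinite. For $\lambda>0$ let $C_n^{(\lambda)}(x)$ be the coefficient of $r^n$ in the power series expansion of $(1-2xr+r^2)^{-\lambda}$ at $r=0$ (Gegenbauer polynomials), let $C_n^{(0)}=T_n$ be the Chebyshev polynomials of the first kind, and put $c_n(d,x)=C_n^{((d-1)/2)}(x)/C_n^{((d-1)/2)}(1)$.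 Put $N_0(d)=1$, $N_n(d)=\frac{d(d+1)\cdots(d+n-2)}{n!}(2n+d-1)$ for $n\ge1$ (the dimension of the space of spherical harmonics of degree $n$ on $\mathbb S^d$; the empty product is $1$), and $\sigma_k=2\pi^{(k+1)/2}/\Gamma((k+1)/2)$ for $k\ge 0$ (the surface area of $\mathbb S^k$). Let $f:[-1,1]\times G\to\mathbb C$ be continuous. Then $f\in\mathcal P(\mathbb S^d,G)$ if and only if there is a sequence $(\varphi_{n,d})_{n\ge0}$ in $\mathcal P(G)$ with $\sum_{n=0}^\infty\varphi_{n,d}(e)<\infty$ such that $$f(\cos\theta,u)=\sum_{n=0}^\infty\varphi_{n,d}(u)\,c_n(d,\cos\theta),\qquad \theta\in[0,\pi],\ u\in G.$$ Moreover, for every such sequence the series converges uniformly for $(\theta,u)\in[0,\pi]\times G$, and for all $n\ge 0$ and $u\in G$ the integrand below is integrable and $$\varphi_{n,d}(u)=\frac{N_n(d)\,\sigma_{d-1}}{\sigma_d}\int_{-1}^1 f(x,u)\,c_n(d,x)\,(1-x^2)^{d/2-1}\,dx .$$ -/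

import Mathlib

open scoped ComplexOrder

noncomputable section

/-- The geodesic distance `θ(ξ, η) = arccos (ξ · η)` on the unit sphere of `ℝ^(d+1)`. -/
def sphereDist {d : ℕ} (ξ η : Metric.sphere (0 : EuclideanSpace ℝ (Fin (d + 1))) 1) : ℝ :=
  Real.arccos (inner ℝ (ξ : EuclideanSpace ℝ (Fin (d + 1))) (η : EuclideanSpace ℝ (Fin (d + 1))))

/-- `cos θ` as an element of `[-1, 1]`. -/
def cosIcc (θ : ℝ) : Set.Icc (-1 : ℝ) 1 := ⟨Real.cos θ, Real.cos_mem_Icc θ⟩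

/-- The class of continuous positive definite functions on the group `G`. -/
def PosDefFun (G : Type*) [Group G] [TopologicalSpace G] : Set (G → ℂ) :=
  {φ | Continuous φ ∧ ∀ (n : ℕ) (u : Fin n → G),
    (Matrix.of fun k l : Fin n => φ ((u k)⁻¹ * u l)).PosSemidef}

/-- The class of continuous functions `f : [-1, 1] × G → ℂ` such that all matrices
`[f (cos θ(ξ_k, ξ_l), u_k⁻¹ u_l)]`, with `(ξ_k, u_k)` in the product of the unit sphere of
`ℝ^(d+1)` and `G`, are (hermitian) positive semidefinite. -/
def SpherePosDef (d : ℕ) (G : Type*) [Group G] [TopologicalSpace G] :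
    Set (Set.Icc (-1 : ℝ) 1 × G → ℂ) :=
  {f | Continuous f ∧
    ∀ (n : ℕ) (ξ : Fin n → Metric.sphere (0 : EuclideanSpace ℝ (Fin (d + 1))) 1) (u : Fin n → G),
      (Matrix.of fun k l : Fin n =>
        f (cosIcc (sphereDist (ξ k) (ξ l)), (u k)⁻¹ * u l)).PosSemidef}

/-- The Gegenbauer polynomial `C_n^(lam)`, evaluated at `x`. For `lam ≠ 0` it is the `n`-th Taylor
coefficient at `r = 0` of the generating function `(1 - 2 x r + r ^ 2) ^ (-lam)`; for `lam = 0` it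
is by convention the Chebyshev polynomial of the first kind. -/
def gegenbauer (lam : ℝ) (n : ℕ) (x : ℝ) : ℝ :=
  if lam = 0 then (Polynomial.Chebyshev.T ℝ (n : ℤ)).eval x
  else iteratedDeriv n (fun r : ℝ => (1 - 2 * x * r + r ^ 2) ^ (-lam)) 0 / (n.factorial : ℝ)

/-- `c_n(d, x)`: the Gegenbauer polynomial with `lam = (d - 1) / 2`, normalized to be `1` at
`x = 1`. -/
def normGegenbauer (n d : ℕ) (x : ℝ) : ℝ :=
  gegenbauer (((d : ℝ) - 1) / 2) n x / gegenbauer (((d : ℝ) - 1) / 2) n 1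

/-- `N_n(d) = (d)_(n-1) / n! * (2 n + d - 1)` for `n ≥ 1` and `N_0(d) = 1`: the dimension of the
space of spherical harmonics of degree `n` on the unit sphere of `ℝ^(d+1)`. -/
def harmonicDim (n d : ℕ) : ℝ :=
  if n = 0 then 1
  else (ascPochhammer ℝ (n - 1)).eval (d : ℝ) / (n.factorial : ℝ) * (2 * (n : ℝ) + (d : ℝ) - 1)

/-- `σ_s = 2 π^((s+1)/2) / Γ((s+1)/2)`: for natural `s`, the surface area of the unit sphere of
`ℝ^(s+1)` (so `σ_0 = 2`). -/
def sphereArea (s : ℝ) : ℝ :=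
  2 * Real.pi ^ ((s + 1) / 2) / Real.Gamma ((s + 1) / 2)

/-- The integrand `f(x, u) c_n(d, x) (1 - x²)^(d/2 - 1)` of the coefficient integral over
`[-1, 1]`; the projection onto `[-1, 1]` is the identity for `x ∈ [-1, 1]` and only serves to read
such a real `x` as a point of the domain of `f`. -/
def coefIntegrand {G : Type*} (d : ℕ) (f : Set.Icc (-1 : ℝ) 1 × G → ℂ) (n : ℕ) (u : G)
    (x : ℝ) : ℂ :=
  f (Set.projIcc (-1 : ℝ) 1 (by norm_num) x, u) * (normGegenbauer n d x : ℂ) *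
    (((1 - x ^ 2) ^ ((d : ℝ) / 2 - 1) : ℝ) : ℂ)

/-- `φ` is a sequence of continuous positive definite functions on `G` with `∑ φ_n(e) < ∞` and
`f(cos θ, u) = ∑ φ_n(u) c_n(d, cos θ)` for all `θ ∈ [0, π]` and `u ∈ G`. -/
def IsSchoenbergSequence {G : Type*} [Group G] [TopologicalSpace G] (d : ℕ)
    (f : Set.Icc (-1 : ℝ) 1 × G → ℂ) (φ : ℕ → G → ℂ) : Prop :=
  (∀ n, φ n ∈ PosDefFun G) ∧ (Summable fun n => φ n 1) ∧
    ∀ θ ∈ Set.Icc 0 Real.pi, ∀ u : G,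
      HasSum (fun n => φ n u * (normGegenbauer n d (Real.cos θ) : ℂ)) (f (cosIcc θ, u))

end

/-! The whole argument rests on one algebraic notion, `IsGegFunctional`: a linear functional `L` on
real polynomials with `L((1 - X²) q' - d X q) = 0` for every `q`. This is integration by parts
against the weight `(1 - x²)^(d/2 - 1)`. Together with the three-term recurrence of the `c_n` it
forces orthogonality, the norms `L(c_n²) = L(1) / N_n(d)`, and uniqueness of `L` up to a factor.
Angular integration `∫ p(cos θ) sin^(d-1) θ dθ` and integration of `p(e · ζ)` over the sphere are
both such functionals, so they are proportional. This gives the zonal integration formula without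
spherical coordinates. The moments on the sphere come from Gaussian integrals over the whole space.

Sufficiency. The convolution of `c_n` with itself over the sphere is a positive multiple of `c_n`
(`gegPoly_convolution`), so its quadratic forms are integrals of squares and `c_n` is positive
definite (`gegPoly_posSemidef`). Schur products and limits of positive semidefinite matrices are
positive semidefinite, which settles the series.

Necessity. The candidate `φ_n` is the Gegenbauer coefficient `gegCoeff`. A quadratic form in `φ_n`
is, up to a positive factor, the double integral over the sphere of a kernel that is positive
definite by the Schur product with `c_n`; such an integral is nonnegative
(`double_integral_nonneg`). Summability of `φ_n(e)` follows by testing against the powers `(1 +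
x)^m`, which have nonnegative coefficients and concentrate at `x = 1` after normalization. Since
`|c_n| ≤ 1` and `|φ_n(u)| ≤ φ_n(e)`, the series converges uniformly. Its sum has the coefficients of
`f`, so it equals `f` by completeness. Termwise integration gives the coefficient formula for any
expansion. -/

noncomputable section

open Polynomial MeasureTheory Filter

/-! ### Normalized Gegenbauer polynomials: recurrence, span, derivative -/

/-- The normalized Gegenbauer polynomials, by their three-term recurrence. -/
def gegPoly (d : ℕ) : ℕ → ℝ[X]
  | 0 => 1
  | 1 => X
  | n + 2 => C ((n + d : ℝ)⁻¹) *
      (C (2 * n + d + 1 : ℝ) * X * gegPoly d (n + 1) - C (n + 1 : ℝ) * gegPoly d n)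

lemma gegPoly_recurrence {d : ℕ} (hd : 1 ≤ d) (n : ℕ) :
    ((n : ℝ[X]) + (d : ℝ[X])) * gegPoly d (n + 2) =
      (2 * (n : ℝ[X]) + (d : ℝ[X]) + 1) * X * gegPoly d (n + 1) - ((n : ℝ[X]) + 1) * gegPoly d n := by
  have h : (n + d : ℝ) ≠ 0 := by positivity
  have h2 : ((n : ℝ[X]) + (d : ℝ[X])) * C ((n + d : ℝ)⁻¹) = 1 := by
    have : ((n : ℝ[X]) + (d : ℝ[X])) = C (n + d : ℝ) := by simp
    rw [this, ← C_mul, mul_inv_cancel₀ h, C_1]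
  simp only [gegPoly]
  rw [← mul_assoc, h2, one_mul]
  simp [C_ofNat]

lemma gegPoly_eval_recurrence {d : ℕ} (hd : 1 ≤ d) (n : ℕ) (x : ℝ) :
    ((n : ℝ) + d) * (gegPoly d (n + 2)).eval x =
      (2 * (n : ℝ) + d + 1) * x * (gegPoly d (n + 1)).eval x
        - ((n : ℝ) + 1) * (gegPoly d n).eval x := by
  simpa using congrArg (eval x) (gegPoly_recurrence hd n)

lemma gegPoly_eval_one {d : ℕ} (hd : 1 ≤ d) : ∀ n, (gegPoly d n).eval 1 = 1
  | 0 => by simp [gegPoly]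
  | 1 => by simp [gegPoly]
  | n + 2 => by
    have h : (n + d : ℝ) ≠ 0 := by positivity
    have := gegPoly_eval_recurrence hd n 1
    rw [gegPoly_eval_one hd n, gegPoly_eval_one hd (n + 1)] at this
    apply mul_left_cancel₀ h
    rw [this]; ring

lemma gegPoly_natDegree_le (d : ℕ) : ∀ n, (gegPoly d n).natDegree ≤ n
  | 0 => by simp [gegPoly]
  | 1 => by simp [gegPoly]
  | n + 2 => by
    have h0 := gegPoly_natDegree_le d n
    have h1 := gegPoly_natDegree_le d (n + 1)
    rw [gegPoly]
    refine (natDegree_C_mul_le _ _).trans ((natDegree_sub_le _ _).trans (max_le ?_ ?_))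
    · rw [mul_assoc]
      refine (natDegree_C_mul_le _ _).trans ((natDegree_mul_le).trans ?_)
      simp only [natDegree_X]; omega
    · exact (natDegree_C_mul_le _ _).trans (by omega)

/-- The span of the first `n + 1` normalized Gegenbauer polynomials. -/
def gegSpan (d n : ℕ) : Submodule ℝ ℝ[X] := Submodule.span ℝ (gegPoly d '' {j | j ≤ n})

lemma gegPoly_mem_gegSpan (d : ℕ) {j n : ℕ} (h : j ≤ n) : gegPoly d j ∈ gegSpan d n :=
  Submodule.subset_span ⟨j, h, rfl⟩

lemma gegSpan_mono (d : ℕ) {m n : ℕ} (h : m ≤ n) : gegSpan d m ≤ gegSpan d n :=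
  Submodule.span_mono (Set.image_mono fun _ hj => le_trans hj h)

/-- `X c_(n+1)` in terms of the neighbouring polynomials. -/
lemma X_mul_gegPoly_succ {d : ℕ} (hd : 1 ≤ d) (n : ℕ) :
    X * gegPoly d (n + 1) = ((n + d : ℝ) / (2 * n + d + 1)) • gegPoly d (n + 2)
      + ((n + 1 : ℝ) / (2 * n + d + 1)) • gegPoly d n := by
  have h : (2 * n + d + 1 : ℝ) ≠ 0 := by positivity
  have h2 := gegPoly_recurrence hd n
  have h3 : (2 * (n : ℝ[X]) + (d : ℝ[X]) + 1) = C (2 * n + d + 1 : ℝ) := by simp [C_ofNat]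
  have h4 : ((n : ℝ[X]) + (d : ℝ[X])) = C (n + d : ℝ) := by simp
  have h5 : ((n : ℝ[X]) + 1) = C (n + 1 : ℝ) := by simp
  have h6 : C (2 * n + d + 1 : ℝ) * C ((2 * n + d + 1 : ℝ)⁻¹) = 1 := by
    rw [← C_mul, mul_inv_cancel₀ h, C_1]
  rw [h3, h4, h5] at h2
  rw [smul_eq_C_mul, smul_eq_C_mul, div_eq_inv_mul, div_eq_inv_mul, C_mul, C_mul]
  linear_combination (-C ((2 * n + d + 1 : ℝ)⁻¹)) * h2 - (X * gegPoly d (n + 1)) * h6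

lemma X_mul_mem_gegSpan {d : ℕ} (hd : 1 ≤ d) {n : ℕ} {p : ℝ[X]} (hp : p ∈ gegSpan d n) :
    X * p ∈ gegSpan d (n + 1) := by
  induction hp using Submodule.span_induction with
  | mem x hx =>
    obtain ⟨j, hj, rfl⟩ := hx
    have hj : j ≤ n := hj
    cases j with
    | zero => simpa [gegPoly] using gegPoly_mem_gegSpan d (show 1 ≤ n + 1 by omega)
    | succ j =>
      rw [X_mul_gegPoly_succ hd]
      exact add_mem (Submodule.smul_mem _ _ (gegPoly_mem_gegSpan d (by omega)))
        (Submodule.smul_mem _ _ (gegPoly_mem_gegSpan d (by omega)))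
  | zero => simp
  | add x y _ _ hx hy => rw [mul_add]; exact add_mem hx hy
  | smul a x _ hx => rw [mul_smul_comm]; exact Submodule.smul_mem _ _ hx

lemma X_pow_mem_gegSpan {d : ℕ} (hd : 1 ≤ d) (n : ℕ) : (X ^ n : ℝ[X]) ∈ gegSpan d n := by
  induction n with
  | zero => simpa [gegPoly] using gegPoly_mem_gegSpan d (le_refl 0)
  | succ n ih => rw [pow_succ']; exact X_mul_mem_gegSpan hd ih

lemma mem_gegSpan_of_natDegree_le {d : ℕ} (hd : 1 ≤ d) {n : ℕ} {p : ℝ[X]}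
    (hp : p.natDegree ≤ n) : p ∈ gegSpan d n := by
  rw [p.as_sum_range_C_mul_X_pow]
  refine Submodule.sum_mem _ fun i hi => ?_
  rw [← smul_eq_C_mul]
  refine Submodule.smul_mem _ _ (gegSpan_mono d ?_ (X_pow_mem_gegSpan hd i))
  have := Finset.mem_range.1 hi
  omega

/-- The derivative relation `(1 - x²) c_(n+1)' = (n + 1) (c_n - x c_(n+1))`. -/
lemma gegPoly_derivative {d : ℕ} (hd : 1 ≤ d) : ∀ n : ℕ,
    (1 - X ^ 2) * derivative (gegPoly d (n + 1)) =
      ((n : ℝ[X]) + 1) * (gegPoly d n - X * gegPoly d (n + 1))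
  | 0 => by simp [gegPoly]; ring
  | 1 => by
    have h0 := gegPoly_recurrence hd 0
    have hd0 : (d : ℝ[X]) ≠ 0 := by exact_mod_cast (by omega : d ≠ 0)
    have e0 : gegPoly d 0 = 1 := by simp [gegPoly]
    have e1 : gegPoly d (0 + 1) = X := by simp [gegPoly]
    rw [e0, e1] at h0
    have h1 := congrArg (derivative (R := ℝ)) h0
    change (1 - X ^ 2) * derivative (gegPoly d (0 + 2)) =
      (((1 : ℕ) : ℝ[X]) + 1) * (gegPoly d (0 + 1) - X * gegPoly d (0 + 2))
    rw [e1]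
    simp only [Nat.cast_zero, zero_add, mul_zero, mul_one, derivative_mul, derivative_sub,
      derivative_natCast, derivative_add, derivative_X, derivative_one, zero_mul,
      Nat.cast_one] at h0 h1 ⊢
    apply mul_left_cancel₀ hd0
    linear_combination (1 - X ^ 2) * h1 + 2 * X * h0
  | n + 2 => by
    have D1 := gegPoly_derivative hd (n + 1)
    have D0 := gegPoly_derivative hd n
    have r1 := gegPoly_recurrence hd (n + 1)
    have r0 := gegPoly_recurrence hd n
    have h1 := congrArg (derivative (R := ℝ)) r1
    have hd0 : ((n : ℝ[X]) + 1 + (d : ℝ[X])) ≠ 0 := by exact_mod_cast (by omega : n + 1 + d ≠ 0)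
    simp only [derivative_mul, derivative_sub, derivative_natCast, derivative_add, derivative_X,
      derivative_one, derivative_ofNat, zero_mul, mul_one, zero_add, mul_zero,
      add_zero, Nat.cast_add, Nat.cast_one, Nat.cast_ofNat, add_assoc, Nat.reduceAdd]
      at h1 r1 r0 D1 D0 ⊢
    -- The differentiated recurrence times `1 - X²`, with both earlier derivative relations
    -- inserted, leaves only multiples of the recurrences at `n` and `n + 1`.
    apply mul_left_cancel₀ hd0
    linear_combination (1 - X ^ 2) * h1 + (2 * n + d + 3) * X * D1 - (n + 2) * D0
      + (n + 3) * X * r1 - (n + 2) * r0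

/-! ### Orthogonality, norms and expansions for Gegenbauer functionals -/

/-- A functional on polynomials that kills the derivatives of `(1 - x²)^(d/2) q`, divided by the
weight. -/
def IsGegFunctional (d : ℕ) (L : ℝ[X] →ₗ[ℝ] ℝ) : Prop :=
  ∀ q : ℝ[X], L ((1 - X ^ 2) * derivative q - (d : ℝ[X]) * (X * q)) = 0

lemma natCast_mul_eq_smul (n : ℕ) (p : ℝ[X]) : (n : ℝ[X]) * p = (n : ℝ) • p := by
  rw [smul_eq_C_mul]; simp

lemma IsGegFunctional.map_gegPoly {d : ℕ} (hd : 1 ≤ d) {L : ℝ[X] →ₗ[ℝ] ℝ}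
    (hL : IsGegFunctional d L) : ∀ n, L (gegPoly d (n + 1)) = 0
  | 0 => by
    have h := hL 1
    have hd0 : (d : ℝ) ≠ 0 := by positivity
    simp only [derivative_one, mul_zero, mul_one, zero_sub, map_neg, neg_eq_zero,
      natCast_mul_eq_smul, map_smul, smul_eq_mul, mul_eq_zero, hd0, false_or] at h
    simpa [gegPoly] using h
  | n + 1 => by
    have h := hL (gegPoly d (n + 1))
    rw [gegPoly_derivative hd n] at h
    have e1 : ((n : ℝ[X]) + 1) * (gegPoly d n - X * gegPoly d (n + 1))
        - (d : ℝ[X]) * (X * gegPoly d (n + 1)) =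
        (n + 1 : ℝ) • gegPoly d n - (n + 1 + d : ℝ) • (X * gegPoly d (n + 1)) := by
      simp only [smul_eq_C_mul, C_add, C_1, map_natCast]; ring
    rw [e1] at h
    -- Eliminating `X c_(n+1)` leaves `c_n` with coefficient `(n + 1) n`: for `n = 0` this factor
    -- removes `L 1`, for larger `n` the induction hypothesis applies.
    have hL0 : (n : ℝ) * L (gegPoly d n) = 0 := by
      cases n with
      | zero => simp
      | succ n => rw [hL.map_gegPoly hd n, mul_zero]
    rw [X_mul_gegPoly_succ hd n] at h
    simp only [map_sub, map_add, map_smul, smul_eq_mul] at h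
    have h1 : (2 * n + d + 1 : ℝ) ≠ 0 := by positivity
    have h2 : (n + 1 + d : ℝ) ≠ 0 := by positivity
    have h3 : (n + d : ℝ) ≠ 0 := by positivity
    field_simp at h
    have : (n + 1 + d : ℝ) * (n + d) * L (gegPoly d (n + 2)) = 0 := by
      linear_combination -h + (n + 1) * hL0
    simpa [h2, h3] using this

/-- Each factor `X` moves the index by at most one, so `k < n` factors never reach `c_0`, the only
polynomial on which `L` may be nonzero. -/
lemma IsGegFunctional.map_mul_gegPoly {d : ℕ} (hd : 1 ≤ d) {L : ℝ[X] →ₗ[ℝ] ℝ}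
    (hL : IsGegFunctional d L) (k : ℕ) : ∀ n, k < n → L (X ^ k * gegPoly d n) = 0 := by
  induction k with
  | zero =>
    rintro (_ | n) hn
    · omega
    · simpa using hL.map_gegPoly hd n
  | succ k ih =>
    rintro (_ | n) hn
    · omega
    · rw [pow_succ, mul_assoc, X_mul_gegPoly_succ hd, mul_add, mul_smul_comm, mul_smul_comm,
        map_add, map_smul, map_smul, ih _ (by omega), ih _ (by omega)]
      simp

lemma IsGegFunctional.map_mul_gegPoly_of_natDegree_lt {d : ℕ} (hd : 1 ≤ d) {L : ℝ[X] →ₗ[ℝ] ℝ}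
    (hL : IsGegFunctional d L) {n : ℕ} {p : ℝ[X]} (hp : p.natDegree < n) :
    L (p * gegPoly d n) = 0 := by
  rw [p.as_sum_range_C_mul_X_pow, Finset.sum_mul, map_sum]
  refine Finset.sum_eq_zero fun i hi => ?_
  have := Finset.mem_range.1 hi
  rw [mul_assoc, ← smul_eq_C_mul, map_smul, hL.map_mul_gegPoly hd i n (by omega), smul_zero]

lemma IsGegFunctional.map_gegPoly_mul_gegPoly {d : ℕ} (hd : 1 ≤ d) {L : ℝ[X] →ₗ[ℝ] ℝ}
    (hL : IsGegFunctional d L) {m n : ℕ} (h : m ≠ n) :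
    L (gegPoly d m * gegPoly d n) = 0 := by
  rcases lt_or_gt_of_ne h with h | h
  · exact hL.map_mul_gegPoly_of_natDegree_lt hd ((gegPoly_natDegree_le d m).trans_lt h)
  · rw [mul_comm]
    exact hL.map_mul_gegPoly_of_natDegree_lt hd ((gegPoly_natDegree_le d n).trans_lt h)

/-- The ratio of consecutive dimensions, in the form needed for the induction on the norms. -/
lemma harmonicDim_succ_succ {d : ℕ} (n : ℕ) :
    (n + 2 : ℝ) * (2 * n + d + 1) * harmonicDim (n + 2) d =
      (n + d) * (2 * n + d + 3) * harmonicDim (n + 1) d := by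
  have h1 : ((n + 1).factorial : ℝ) ≠ 0 := by positivity
  simp only [harmonicDim, Nat.add_eq_zero_iff, OfNat.ofNat_ne_zero, one_ne_zero, and_false,
    if_false, show n + 2 - 1 = n + 1 from rfl, Nat.add_sub_cancel, ascPochhammer_succ_eval,
    Nat.factorial_succ (n + 1)]
  push_cast
  have h2 : (n : ℝ) + 1 + 1 ≠ 0 := by positivity
  field_simp
  ring

lemma harmonicDim_pos {d : ℕ} (hd : 1 ≤ d) (n : ℕ) : 0 < harmonicDim n d := by
  unfold harmonicDim
  split_ifs with h
  · exact one_pos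
  · have h1 : (1 : ℝ) ≤ n := by exact_mod_cast Nat.one_le_iff_ne_zero.2 h
    have h2 : (1 : ℝ) ≤ d := by exact_mod_cast hd
    have := ascPochhammer_pos (n - 1) (d : ℝ) (by linarith)
    have h3 : 0 < 2 * (n : ℝ) + d - 1 := by linarith
    positivity

/-- In `L(X c_(n+1) c_(n+2))` the factor `X` can be absorbed by either polynomial. By orthogonality
one term survives each time, which relates `L(c_(n+2)²)` to `L(c_(n+1)²)` by the inverse ratio of
the dimensions. -/
lemma IsGegFunctional.map_gegPoly_sq {d : ℕ} (hd : 1 ≤ d) {L : ℝ[X] →ₗ[ℝ] ℝ}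
    (hL : IsGegFunctional d L) : ∀ n, harmonicDim n d * L (gegPoly d n * gegPoly d n) = L 1
  | 0 => by simp [harmonicDim, gegPoly]
  | 1 => by
    have h := hL X
    have e : (1 - X ^ 2) * derivative (X : ℝ[X]) - (d : ℝ[X]) * (X * X) = 1 - (d + 1 : ℝ) • (X * X) := by
      simp only [smul_eq_C_mul, C_add, C_1, map_natCast, derivative_X]; ring
    rw [e, map_sub, map_smul, smul_eq_mul] at h
    simp only [harmonicDim, gegPoly]
    norm_num
    linarith
  | n + 2 => by
    have ih := hL.map_gegPoly_sq hd (n + 1)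
    have h1 := hL.map_gegPoly_mul_gegPoly hd (show n ≠ n + 2 by omega)
    have h2 := hL.map_gegPoly_mul_gegPoly hd (show n + 3 ≠ n + 1 by omega)
    have e1 := congrArg (fun p => L (p * gegPoly d (n + 2))) (X_mul_gegPoly_succ hd n)
    have e2 := congrArg (fun p => L (p * gegPoly d (n + 1))) (X_mul_gegPoly_succ hd (n + 1))
    simp only [add_mul, smul_mul_assoc, map_add, map_smul, smul_eq_mul, h1, h2, mul_zero,
      add_zero, zero_add] at e1 e2
    have e3 : X * gegPoly d (n + 1) * gegPoly d (n + 2) =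
      X * gegPoly d (n + 1 + 1) * gegPoly d (n + 1) := by ring
    rw [e3, e2] at e1
    have hN := harmonicDim_succ_succ (d := d) n
    have p1 : (2 * n + d + 1 : ℝ) ≠ 0 := by positivity
    have p2 : (2 * n + d + 3 : ℝ) ≠ 0 := by positivity
    have p3 : (n + 2 : ℝ) ≠ 0 := by positivity
    have p4 : (n + d : ℝ) ≠ 0 := by positivity
    push_cast at e1
    have p5 : (2 * (n + 1) + d + 1 : ℝ) ≠ 0 := by positivity
    field_simp at e1
    rw [← ih]
    have key : (n + d : ℝ) * (2 * n + d + 3) * (harmonicDim (n + 2) d *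
        L (gegPoly d (n + 2) * gegPoly d (n + 2))) = (n + d : ℝ) * (2 * n + d + 3) *
        (harmonicDim (n + 1) d * L (gegPoly d (n + 1) * gegPoly d (n + 1))) := by
      linear_combination L (gegPoly d (n + 1) * gegPoly d (n + 1)) * hN
        - harmonicDim (n + 2) d * e1
    exact mul_left_cancel₀ (mul_ne_zero p4 p2) key

/-- Two functionals with the Gegenbauer property are proportional. -/
lemma IsGegFunctional.proportional {d : ℕ} (hd : 1 ≤ d) {L M : ℝ[X] →ₗ[ℝ] ℝ}
    (hL : IsGegFunctional d L) (hM : IsGegFunctional d M) (p : ℝ[X]) :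
    L 1 * M p = M 1 * L p := by
  obtain ⟨n, hp⟩ : ∃ n, p ∈ gegSpan d n := ⟨_, mem_gegSpan_of_natDegree_le hd le_rfl⟩
  induction hp using Submodule.span_induction with
  | mem x hx =>
    obtain ⟨j, hj, rfl⟩ := hx
    cases j with
    | zero => simp [gegPoly, mul_comm]
    | succ j => simp [hL.map_gegPoly hd, hM.map_gegPoly hd]
  | zero => simp
  | add x y _ _ hx hy => rw [map_add, map_add, mul_add, mul_add, hx, hy]
  | smul a x _ hx => rw [map_smul, map_smul, mul_smul_comm, mul_smul_comm, hx]

/-- The Gegenbauer expansion of a polynomial. -/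
lemma IsGegFunctional.expansion {d : ℕ} (hd : 1 ≤ d) {L : ℝ[X] →ₗ[ℝ] ℝ}
    (hL : IsGegFunctional d L) (hL1 : L 1 ≠ 0) {n : ℕ} {p : ℝ[X]} (hp : p.natDegree ≤ n) :
    p = ∑ j ∈ Finset.range (n + 1),
      (harmonicDim j d / L 1 * L (p * gegPoly d j)) • gegPoly d j := by
  replace hp : p ∈ gegSpan d n := mem_gegSpan_of_natDegree_le hd hp
  induction hp using Submodule.span_induction with
  | mem x hx =>
    obtain ⟨k, hk, rfl⟩ := hx
    have hk : k ≤ n := hk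
    rw [Finset.sum_eq_single k]
    · rw [div_mul_eq_mul_div, hL.map_gegPoly_sq hd, div_self hL1, one_smul]
    · intro j _ hj
      rw [hL.map_gegPoly_mul_gegPoly hd hj.symm, mul_zero, zero_smul]
    · intro h; simp at h; omega
  | zero => simp
  | add x y _ _ hx hy =>
    simp only [add_mul, map_add, mul_add, add_smul, Finset.sum_add_distrib]
    rw [← hx, ← hy]
  | smul a x _ hx =>
    conv_lhs => rw [hx]
    rw [Finset.smul_sum]
    refine Finset.sum_congr rfl fun j _ => ?_
    rw [smul_mul_assoc, map_smul, smul_smul, smul_eq_mul]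
    congr 1; ring

/-! ### Sphere integrals through Gaussian integrals -/

/-- The moments of the Gaussian weight on the half line. -/
def gaussMoment (k : ℕ) : ℝ := ∫ r in Set.Ioi (0 : ℝ), r ^ k * Real.exp (-(1 / 2) * r ^ 2)

lemma gaussMoment_eq (k : ℕ) :
    gaussMoment k = (1 / 2 : ℝ) ^ (-((k : ℝ) + 1) / 2) * (1 / 2) * Real.Gamma (((k : ℝ) + 1) / 2) := by
  have h := integral_rpow_mul_exp_neg_mul_rpow (p := 2) (q := k) (b := 1 / 2) (by norm_num)
    (by linarith [(Nat.cast_nonneg k : (0 : ℝ) ≤ k)]) (by norm_num)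
  simp only [Real.rpow_natCast, Real.rpow_ofNat] at h
  exact h

lemma gaussMoment_pos (k : ℕ) : 0 < gaussMoment k := by
  rw [gaussMoment_eq]
  have := Real.Gamma_pos_of_pos (s := ((k : ℝ) + 1) / 2) (by positivity)
  positivity

lemma gaussMoment_add_two (k : ℕ) : gaussMoment (k + 2) = (k + 1) * gaussMoment k := by
  rw [gaussMoment_eq, gaussMoment_eq]
  have h1 : (((k + 2 : ℕ) : ℝ) + 1) / 2 = ((k : ℝ) + 1) / 2 + 1 := by push_cast; ring
  have h2 : -(((k + 2 : ℕ) : ℝ) + 1) / 2 = -((k : ℝ) + 1) / 2 - 1 := by push_cast; ring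
  rw [h1, h2, Real.Gamma_add_one (by positivity), Real.rpow_sub_one (by norm_num)]
  field_simp

lemma abs_inner_pow_mul_le {E : Type*} [NormedAddCommGroup E] [InnerProductSpace ℝ E] {ξ η : E}
    (hξ : ‖ξ‖ = 1) (hη : ‖η‖ = 1) (a b : ℕ) (x : E) :
    |inner ℝ ξ x ^ a * inner ℝ η x ^ b| ≤ ‖x‖ ^ (a + b) := by
  have h1 := abs_real_inner_le_norm ξ x
  have h2 := abs_real_inner_le_norm η x
  rw [hξ, one_mul] at h1
  rw [hη, one_mul] at h2
  rw [abs_mul, abs_pow, abs_pow, pow_add]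
  gcongr

section

variable {E : Type*} [NormedAddCommGroup E] [InnerProductSpace ℝ E] [FiniteDimensional ℝ E]
  [MeasurableSpace E] [BorelSpace E]

/-- Polar coordinates: homogeneity contributes `r^k` and the volume element `r^(dim E - 1)`. Sphere
integrals thus become integrals over a vector space, where integration by parts needs no surface
calculus. -/
lemma integral_homogeneous_mul_gaussian [Nontrivial E] {F : E → ℝ} {k : ℕ}
    (hF : ∀ (r : ℝ) (x : E), F (r • x) = r ^ k * F x) :
    ∫ x : E, F x * Real.exp (-(1 / 2) * ‖x‖ ^ 2) =
      (∫ ζ : Metric.sphere (0 : E) 1, F ζ ∂(volume : Measure E).toSphere) *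
        gaussMoment (k + (Module.finrank ℝ E - 1)) := by
  set μ : Measure E := volume
  set g : E → ℝ := fun x => F x * Real.exp (-(1 / 2) * ‖x‖ ^ 2)
  have h1 : ∫ x, g x ∂μ = ∫ x : ({(0)}ᶜ : Set E), g x.1 ∂(μ.comap (↑)) := by
    rw [integral_subtype_comap (measurableSet_singleton _).compl g, restrict_compl_singleton]
  have h2 : ∫ x : ({(0)}ᶜ : Set E), g x.1 ∂(μ.comap (↑)) =
      ∫ p : Metric.sphere (0 : E) 1 × Set.Ioi (0 : ℝ),
        F p.1 * (p.2.1 ^ k * Real.exp (-(1 / 2) * p.2.1 ^ 2))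
          ∂μ.toSphere.prod (.volumeIoiPow (Module.finrank ℝ E - 1)) := by
    rw [← μ.measurePreserving_homeomorphUnitSphereProd.integral_comp
        (Homeomorph.measurableEmbedding _)]
    refine integral_congr_ae (.of_forall fun x => ?_)
    have hx : ‖x.1‖ ≠ 0 := norm_ne_zero_iff.2 x.2
    simp only [g, homeomorphUnitSphereProd_apply_fst_coe, homeomorphUnitSphereProd_apply_snd_coe]
    have hk : (‖x.1‖⁻¹) ^ k * ‖x.1‖ ^ k = 1 := by rw [← mul_pow, inv_mul_cancel₀ hx, one_pow]
    rw [hF]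
    linear_combination (-(F x.1 * Real.exp (-(1 / 2) * ‖x.1‖ ^ 2))) * hk
  have h3 : ∫ r : Set.Ioi (0 : ℝ), r.1 ^ k * Real.exp (-(1 / 2) * r.1 ^ 2)
      ∂(.volumeIoiPow (Module.finrank ℝ E - 1)) = gaussMoment (k + (Module.finrank ℝ E - 1)) := by
    simp only [Measure.volumeIoiPow, ENNReal.ofReal]
    rw [integral_withDensity_eq_integral_smul,
      integral_subtype_comap measurableSet_Ioi fun a : ℝ =>
        Real.toNNReal (a ^ (Module.finrank ℝ E - 1)) • (a ^ k * Real.exp (-(1 / 2) * a ^ 2)),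
      gaussMoment]
    · refine setIntegral_congr_fun measurableSet_Ioi fun x hx => ?_
      simp only [NNReal.smul_def, Real.coe_toNNReal _ (pow_nonneg (Set.mem_Ioi.1 hx).le _)]
      rw [smul_eq_mul, pow_add]; ring
    · exact (measurable_subtype_coe.pow_const _).real_toNNReal
  rw [h1, h2, integral_prod_mul (fun ζ : Metric.sphere (0 : E) 1 => F ζ)
    (fun r : Set.Ioi (0 : ℝ) => r.1 ^ k * Real.exp (-(1 / 2) * r.1 ^ 2)), h3]

lemma integrable_mul_gaussian [Nontrivial E] {F : E → ℝ} (hF : Continuous F) {k : ℕ}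
    (hb : ∀ x, |F x| ≤ ‖x‖ ^ k) :
    Integrable fun x : E => F x * Real.exp (-(1 / 2) * ‖x‖ ^ 2) := by
  have h : Integrable fun x : E => ‖x‖ ^ k * Real.exp (-(1 / 2) * ‖x‖ ^ 2) := by
    rw [integrable_fun_norm_addHaar (volume : Measure E)
      (f := fun r => r ^ k * Real.exp (-(1 / 2) * r ^ 2))]
    have := (integrable_rpow_mul_exp_neg_mul_sq (b := 1 / 2) (by norm_num)
      (s := (Module.finrank ℝ E - 1 + k : ℕ)) (by
        linarith [(Nat.cast_nonneg _ : (0 : ℝ) ≤ (Module.finrank ℝ E - 1 + k : ℕ))])).integrableOn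
          (s := Set.Ioi 0)
    refine this.congr_fun (fun r _ => ?_) measurableSet_Ioi
    simp only [Real.rpow_natCast, smul_eq_mul, pow_add, mul_assoc]
  refine h.mono (by fun_prop) (.of_forall fun x => ?_)
  rw [norm_mul, norm_mul, Real.norm_eq_abs, norm_pow, norm_norm]
  gcongr
  exact hb x

/-- The Gaussian mixed moments of two linear functionals. -/
def gaussMixed (ξ η : E) (a b : ℕ) : ℝ :=
  ∫ x : E, (inner ℝ ξ x ^ a * inner ℝ η x ^ b) * Real.exp (-(1 / 2) * ‖x‖ ^ 2)

lemma integrable_gaussMixed [Nontrivial E] {ξ η : E} (hξ : ‖ξ‖ = 1) (hη : ‖η‖ = 1) (a b : ℕ) :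
    Integrable fun x : E =>
      (inner ℝ ξ x ^ a * inner ℝ η x ^ b) * Real.exp (-(1 / 2) * ‖x‖ ^ 2) :=
  integrable_mul_gaussian (by fun_prop) (abs_inner_pow_mul_le hξ hη a b)

lemma gaussMixed_comm (ξ η : E) (a b : ℕ) : gaussMixed ξ η a b = gaussMixed η ξ b a := by
  unfold gaussMixed
  simp only [mul_comm]

/-- Gaussian integration by parts. -/
lemma gaussMixed_succ [Nontrivial E] {ξ η : E} (hξ : ‖ξ‖ = 1) (hη : ‖η‖ = 1) (a b : ℕ) :
    gaussMixed ξ η (a + 1) b =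
      a * gaussMixed ξ η (a - 1) b + b * inner ℝ ξ η * gaussMixed ξ η a (b - 1) := by
  have hξξ : inner ℝ ξ ξ = (1 : ℝ) := by rw [real_inner_self_eq_norm_sq, hξ]; norm_num
  -- The derivative of the Gaussian along `ξ` is `-⟨ξ, x⟩` times the Gaussian, so it absorbs one
  -- factor `⟨ξ, x⟩`. The truncated exponents `a - 1`, `b - 1` are harmless because they come with
  -- factors `a`, `b`.
  have key := integral_bilinear_hasLineDerivAt_right_eq_neg_left_of_integrable
    (μ := (volume : Measure E)) (B := ContinuousLinearMap.mul ℝ ℝ) (v := ξ)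
    (f := fun x => inner ℝ ξ x ^ a * inner ℝ η x ^ b)
    (f' := fun x => a * inner ℝ ξ x ^ (a - 1) * inner ℝ η x ^ b
      + inner ℝ ξ x ^ a * (b * inner ℝ η x ^ (b - 1) * inner ℝ ξ η))
    (g := fun x => Real.exp (-(1 / 2) * ‖x‖ ^ 2))
    (g' := fun x => -inner ℝ ξ x * Real.exp (-(1 / 2) * ‖x‖ ^ 2)) ?_ ?_ ?_ ?_ ?_
  · simp only [ContinuousLinearMap.mul_apply'] at key
    have e1 : gaussMixed ξ η (a + 1) b = -∫ x : E, inner ℝ ξ x ^ a * inner ℝ η x ^ b *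
        (-inner ℝ ξ x * Real.exp (-(1 / 2) * ‖x‖ ^ 2)) := by
      rw [← integral_neg, gaussMixed]
      congr 1; ext x; ring
    rw [e1, key, neg_neg, gaussMixed, gaussMixed, ← integral_const_mul, ← integral_const_mul,
      ← integral_add ((integrable_gaussMixed hξ hη _ _).const_mul _)
        ((integrable_gaussMixed hξ hη _ _).const_mul _)]
    congr 1; ext x; ring
  · simp only [ContinuousLinearMap.mul_apply']
    refine (((integrable_gaussMixed hξ hη (a - 1) b).const_mul a).add
      ((integrable_gaussMixed hξ hη a (b - 1)).const_mul (b * inner ℝ ξ η))).congr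
        (.of_forall fun x => ?_)
    simp only [Pi.add_apply]; ring
  · simp only [ContinuousLinearMap.mul_apply']
    refine (integrable_gaussMixed hξ hη (a + 1) b).neg.congr (.of_forall fun x => ?_)
    simp only [Pi.neg_apply]; ring
  · exact integrable_gaussMixed hξ hη a b
  · intro x _
    have h1 : ∀ v : E, HasDerivAt (fun t : ℝ => inner ℝ v (x + t • ξ)) (inner ℝ v ξ) 0 := by
      intro v
      simp only [inner_add_right, inner_smul_right]
      simpa using ((hasDerivAt_id (0 : ℝ)).mul_const (inner ℝ v ξ)).const_add (inner ℝ v x)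
    have h2 := ((h1 ξ).pow a).mul ((h1 η).pow b)
    rw [HasLineDerivAt]
    refine h2.congr_deriv ?_
    simp only [zero_smul, add_zero, hξξ, mul_one, real_inner_comm ξ η, Pi.pow_apply]
  · intro x _
    have h0 : ∀ t : ℝ, ‖x + t • ξ‖ ^ 2 = ‖x‖ ^ 2 + 2 * t * inner ℝ ξ x + t ^ 2 := by
      intro t
      rw [norm_add_sq_real, norm_smul, hξ, inner_smul_right, real_inner_comm, mul_one,
        Real.norm_eq_abs, sq_abs]
      ring
    rw [HasLineDerivAt]
    simp only [h0]
    have h1 : HasDerivAt (fun t : ℝ => -(1 / 2) * (‖x‖ ^ 2 + 2 * t * inner ℝ ξ x + t ^ 2))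
        (-inner ℝ ξ x) 0 := by
      have := (((((hasDerivAt_id (0 : ℝ)).const_mul 2).mul_const (inner ℝ ξ x)).const_add
        (‖x‖ ^ 2)).add ((hasDerivAt_id (0 : ℝ)).pow 2)).const_mul (-(1 / 2) : ℝ)
      exact this.congr_deriv (by simp)
    exact h1.exp.congr_deriv (by simp [mul_comm])

/-- Integration by parts either removes two factors `⟨ξ, x⟩`, or one factor of each kind at the
price of one factor `⟨ξ, η⟩`. The second can happen at most `min a b` times, whence the degree
bound. -/
lemma exists_poly_gaussMixed [Nontrivial E] : ∀ s a b : ℕ, a + b = s → ∃ P : ℝ[X],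
    P.natDegree ≤ min a b ∧ ∀ ξ η : E, ‖ξ‖ = 1 → ‖η‖ = 1 →
      gaussMixed ξ η a b = P.eval (inner ℝ ξ η) := by
  intro s
  induction s using Nat.strong_induction_on with
  | _ s ih =>
    rintro (_ | a) b hs
    · rcases b with _ | b
      · exact ⟨C (∫ x : E, Real.exp (-(1 / 2) * ‖x‖ ^ 2)), by simp, by simp [gaussMixed]⟩
      · obtain ⟨P, hP, h⟩ := ih (b - 1 + 0) (by omega) 0 (b - 1) (by omega)
        refine ⟨C (b : ℝ) * P, (natDegree_C_mul_le _ _).trans (by simpa using hP),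
          fun ξ η hξ hη => ?_⟩
        rw [gaussMixed_comm, gaussMixed_succ hη hξ, gaussMixed_comm, h ξ η hξ hη]
        simp
    · obtain ⟨P, hP, h⟩ : ∃ P : ℝ[X], (C (a : ℝ) * P).natDegree ≤ min (a + 1) b ∧
          ∀ ξ η : E, ‖ξ‖ = 1 → ‖η‖ = 1 →
            (a : ℝ) * gaussMixed ξ η (a - 1) b = a * P.eval (inner ℝ ξ η) := by
        obtain ⟨P, hP, h⟩ := ih (a - 1 + b) (by omega) (a - 1) b rfl
        exact ⟨P, (natDegree_C_mul_le _ _).trans (hP.trans (by omega)),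
          fun ξ η hξ hη => by rw [h ξ η hξ hη]⟩
      obtain ⟨Q, hQ, h'⟩ : ∃ Q : ℝ[X], (C (b : ℝ) * X * Q).natDegree ≤ min (a + 1) b ∧
          ∀ ξ η : E, ‖ξ‖ = 1 → ‖η‖ = 1 →
            (b : ℝ) * inner ℝ ξ η * gaussMixed ξ η a (b - 1)
              = b * inner ℝ ξ η * Q.eval (inner ℝ ξ η) := by
        rcases b with _ | b
        · exact ⟨0, by simp, by simp⟩
        · obtain ⟨Q, hQ, h⟩ := ih (a + b) (by omega) a b rfl
          refine ⟨Q, ?_, fun ξ η hξ hη => by rw [Nat.add_sub_cancel, h ξ η hξ hη]⟩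
          rw [mul_assoc]
          refine (natDegree_C_mul_le _ _).trans (natDegree_mul_le.trans ?_)
          rw [natDegree_X]; omega
      refine ⟨C (a : ℝ) * P + C (b : ℝ) * X * Q,
        (natDegree_add_le _ _).trans (max_le hP hQ), fun ξ η hξ hη => ?_⟩
      rw [gaussMixed_succ hξ hη, h ξ η hξ hη, h' ξ η hξ hη]
      simp

/-- The surface measure of the unit sphere. -/
abbrev sphereMeasure (E : Type*) [NormedAddCommGroup E] [InnerProductSpace ℝ E]
    [FiniteDimensional ℝ E] [MeasurableSpace E] [BorelSpace E] :
    Measure (Metric.sphere (0 : E) 1) := (volume : Measure E).toSphere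

lemma gaussMixed_eq_sphere [Nontrivial E] (ξ η : E) (a b : ℕ) :
    gaussMixed ξ η a b = (∫ ζ : Metric.sphere (0 : E) 1,
      inner ℝ ξ (ζ : E) ^ a * inner ℝ η (ζ : E) ^ b ∂sphereMeasure E) *
        gaussMoment (a + b + (Module.finrank ℝ E - 1)) := by
  rw [gaussMixed, integral_homogeneous_mul_gaussian (k := a + b)
    (F := fun x : E => inner ℝ ξ x ^ a * inner ℝ η x ^ b)]
  intro r x
  simp only [inner_smul_right, mul_pow, pow_add]
  ring

lemma integrable_sphere_of_continuous {F : Type*} [NormedAddCommGroup F]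
    {f : Metric.sphere (0 : E) 1 → F} (hf : Continuous f) : Integrable f (sphereMeasure E) := by
  rw [← integrableOn_univ]
  exact hf.continuousOn.integrableOn_compact isCompact_univ

/-- Integrating the product of two zonal polynomials yields a zonal polynomial of the lower of the
two degrees. -/
lemma exists_poly_sphere_integral [Nontrivial E] {m n : ℕ} {p q : ℝ[X]} (hp : p.natDegree ≤ m)
    (hq : q.natDegree ≤ n) : ∃ r : ℝ[X], r.natDegree ≤ min m n ∧
      ∀ ξ η : E, ‖ξ‖ = 1 → ‖η‖ = 1 →
        ∫ ζ : Metric.sphere (0 : E) 1, p.eval (inner ℝ ξ (ζ : E)) * q.eval (inner ℝ η (ζ : E))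
          ∂sphereMeasure E = r.eval (inner ℝ ξ η) := by
  choose P hP h using fun a b : ℕ => exists_poly_gaussMixed (E := E) _ a b rfl
  -- Monomial by monomial, the sphere integral is the Gaussian moment divided by a radial moment
  -- depending only on `i + j`.
  refine ⟨∑ i ∈ Finset.range (m + 1), ∑ j ∈ Finset.range (n + 1),
    C (p.coeff i * q.coeff j * (gaussMoment (i + j + (Module.finrank ℝ E - 1)))⁻¹) * P i j, ?_,
      fun ξ η hξ hη => ?_⟩
  · refine natDegree_sum_le_of_forall_le _ _ fun i hi => natDegree_sum_le_of_forall_le _ _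
      fun j hj => (natDegree_C_mul_le _ _).trans ((hP i j).trans ?_)
    have := Finset.mem_range.1 hi
    have := Finset.mem_range.1 hj
    omega
  · have e : ∀ ζ : Metric.sphere (0 : E) 1,
        p.eval (inner ℝ ξ (ζ : E)) * q.eval (inner ℝ η (ζ : E)) =
          ∑ i ∈ Finset.range (m + 1), ∑ j ∈ Finset.range (n + 1),
            p.coeff i * q.coeff j * (inner ℝ ξ (ζ : E) ^ i * inner ℝ η (ζ : E) ^ j) := by
      intro ζ
      rw [eval_eq_sum_range' (Nat.lt_succ_of_le hp), eval_eq_sum_range' (Nat.lt_succ_of_le hq),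
        Finset.sum_mul_sum]
      refine Finset.sum_congr rfl fun i _ => Finset.sum_congr rfl fun j _ => by ring
    simp only [e, eval_finsetSum, eval_mul, eval_C]
    rw [integral_finsetSum]
    · refine Finset.sum_congr rfl fun i _ => ?_
      rw [integral_finsetSum]
      · refine Finset.sum_congr rfl fun j _ => ?_
        rw [integral_const_mul, ← h i j ξ η hξ hη, gaussMixed_eq_sphere]
        have := (gaussMoment_pos (i + j + (Module.finrank ℝ E - 1))).ne'
        field_simp
      · intro j _
        exact integrable_sphere_of_continuous (by fun_prop)
    · intro i _
      exact integrable_sphere_of_continuous (by fun_prop)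

/-- Integration of a zonal polynomial over the sphere. -/
def zonalFunctional (e : E) : ℝ[X] →ₗ[ℝ] ℝ where
  toFun p := ∫ ζ : Metric.sphere (0 : E) 1, p.eval (inner ℝ e (ζ : E)) ∂sphereMeasure E
  map_add' p q := by
    simp only [eval_add]
    exact integral_add (integrable_sphere_of_continuous (by fun_prop))
      (integrable_sphere_of_continuous (by fun_prop))
  map_smul' a p := by
    simp only [eval_smul, smul_eq_mul, RingHom.id_apply]
    exact integral_const_mul _ _

lemma zonalFunctional_apply (e : E) (p : ℝ[X]) : zonalFunctional e p =
    ∫ ζ : Metric.sphere (0 : E) 1, p.eval (inner ℝ e (ζ : E)) ∂sphereMeasure E := rfl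

lemma zonalFunctional_X_pow [Nontrivial E] (e : E) (k : ℕ) :
    zonalFunctional e (X ^ k) * gaussMoment (k + (Module.finrank ℝ E - 1)) =
      gaussMixed e e k 0 := by
  rw [gaussMixed_eq_sphere, zonalFunctional_apply]
  simp

/-- The defining identity is linear in `q`; on monomials it is precisely this two-step recursion for
moments. -/
lemma isGegFunctional_of_X_pow {d : ℕ} {L : ℝ[X] →ₗ[ℝ] ℝ} (h1 : L X = 0)
    (h2 : ∀ k : ℕ, (k + 1 + d : ℝ) * L (X ^ (k + 2)) = (k + 1) * L (X ^ k)) :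
    IsGegFunctional d L := by
  intro q
  induction q using Polynomial.induction_on' with
  | add p q hp hq =>
    rw [derivative_add]
    have : (1 - X ^ 2) * (derivative p + derivative q) - (d : ℝ[X]) * (X * (p + q)) =
      ((1 - X ^ 2) * derivative p - (d : ℝ[X]) * (X * p)) +
        ((1 - X ^ 2) * derivative q - (d : ℝ[X]) * (X * q)) := by ring
    rw [this, map_add, hp, hq, add_zero]
  | monomial n a =>
    rw [← C_mul_X_pow_eq_monomial]
    rcases n with _ | n
    · have : (1 - X ^ 2) * derivative (C a * X ^ 0) - (d : ℝ[X]) * (X * (C a * X ^ 0))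
        = (-(d * a) : ℝ) • X := by
        simp [smul_eq_C_mul]; ring
      rw [this, map_smul, h1, smul_zero]
    · have : (1 - X ^ 2) * derivative (C a * X ^ (n + 1)) - (d : ℝ[X]) * (X * (C a * X ^ (n + 1)))
        = (a * (n + 1) : ℝ) • X ^ n - (a * (n + 1 + d) : ℝ) • X ^ (n + 2) := by
        simp [smul_eq_C_mul]; ring
      rw [this, map_sub, map_smul, map_smul, smul_eq_mul, smul_eq_mul]
      linear_combination -a * h2 n

/-- The Gaussian moments grow by `k + 1` from degree `k` to `k + 2` and the radial ones by `k + d +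
1`; the quotient gives the required recursion. -/
lemma isGegFunctional_zonalFunctional {d : ℕ} (hd : 1 ≤ d) (hE : Module.finrank ℝ E = d + 1)
    {e : E} (he : ‖e‖ = 1) : IsGegFunctional d (zonalFunctional e) := by
  have : Nontrivial E := Module.nontrivial_of_finrank_pos (R := ℝ) (by omega)
  refine isGegFunctional_of_X_pow ?_ fun k => ?_
  · have h := zonalFunctional_X_pow e 1
    have h2 := gaussMixed_succ he he 0 0
    simp only [Nat.cast_zero, zero_mul, zero_add] at h2
    rw [h2, pow_one] at h
    exact (mul_eq_zero.1 h).resolve_right (gaussMoment_pos _).ne'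
  · have h0 := zonalFunctional_X_pow e k
    have h2 := zonalFunctional_X_pow e (k + 2)
    have h := gaussMixed_succ he he (k + 1) 0
    simp only [Nat.cast_zero, zero_mul, add_zero, Nat.add_sub_cancel] at h
    rw [h, ← h0, hE, show k + 2 + (d + 1 - 1) = k + (d + 1 - 1) + 2 by omega,
      gaussMoment_add_two, Nat.add_sub_cancel] at h2
    have hp := (gaussMoment_pos (k + d)).ne'
    apply mul_right_cancel₀ hp
    push_cast at h2
    linear_combination h2

end

/-! ### Agreement with the generating-function definition -/

/-- Three-term relation for the derivatives of the generating function of the Gegenbauer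
polynomials. -/
lemma iteratedDeriv_genFun (lam x : ℝ) (n : ℕ) : ∀ r : ℝ, 0 < 1 - 2 * x * r + r ^ 2 →
    (1 - 2 * x * r + r ^ 2) *
      iteratedDeriv (n + 2) (fun r : ℝ => (1 - 2 * x * r + r ^ 2) ^ (-lam)) r =
    2 * (n + 1 + lam) * (x - r) *
      iteratedDeriv (n + 1) (fun r : ℝ => (1 - 2 * x * r + r ^ 2) ^ (-lam)) r -
    (n + 1) * (n + 2 * lam) *
      iteratedDeriv n (fun r : ℝ => (1 - 2 * x * r + r ^ 2) ^ (-lam)) r := by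
  set g : ℝ → ℝ := fun r => (1 - 2 * x * r + r ^ 2) ^ (-lam) with hg
  have hq : ∀ r : ℝ, HasDerivAt (fun r : ℝ => 1 - 2 * x * r + r ^ 2) (-2 * (x - r)) r := by
    intro r
    have := (((hasDerivAt_id r).const_mul (2 * x)).const_sub 1).add ((hasDerivAt_id r).pow 2)
    exact this.congr_deriv (by simp; ring)
  have hU : IsOpen {r : ℝ | 0 < 1 - 2 * x * r + r ^ 2} :=
    isOpen_lt continuous_const (by fun_prop)
  have hd : ∀ (n : ℕ) (r : ℝ), 0 < 1 - 2 * x * r + r ^ 2 →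
      HasDerivAt (iteratedDeriv n g) (iteratedDeriv (n + 1) g r) r := by
    intro n r hr
    rw [iteratedDeriv_succ]
    apply DifferentiableAt.hasDerivAt
    have hc : ContDiffAt ℝ (n + 1 : ℕ) g r :=
      ContDiffAt.rpow_const_of_ne (by fun_prop) hr.ne'
    have := (contDiffWithinAt_univ.2 hc).differentiableWithinAt_iteratedDerivWithin (m := n)
      (by exact_mod_cast Nat.lt_succ_self n) (by simp [uniqueDiffOn_univ])
    rwa [iteratedDerivWithin_univ, differentiableWithinAt_univ] at this
  -- Where the base is positive, an open set, an identity between functions may be differentiated.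
  have hderiv : ∀ {F G F' G' : ℝ → ℝ}, (∀ r, 0 < 1 - 2 * x * r + r ^ 2 → F r = G r) →
      (∀ r, 0 < 1 - 2 * x * r + r ^ 2 → HasDerivAt F (F' r) r) →
      (∀ r, 0 < 1 - 2 * x * r + r ^ 2 → HasDerivAt G (G' r) r) →
      ∀ r, 0 < 1 - 2 * x * r + r ^ 2 → F' r = G' r := by
    intro F G F' G' h hF hG r hr
    have : F =ᶠ[nhds r] G := Filter.eventually_of_mem (hU.mem_nhds hr) h
    exact (hF r hr).unique ((hG r hr).congr_of_eventuallyEq this)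
  have hx : ∀ r : ℝ, HasDerivAt (fun r : ℝ => x - r) (-1) r := fun r =>
    (hasDerivAt_id r).const_sub x
  induction n with
  | zero =>
    -- With `q = 1 - 2xr + r²`, this is the equation `q g' = 2 lam (x - r) g`; its derivative of
    -- order `n + 1` is the claim.
    have h0 : ∀ r, 0 < 1 - 2 * x * r + r ^ 2 →
        (1 - 2 * x * r + r ^ 2) * iteratedDeriv 1 g r = 2 * lam * (x - r) * iteratedDeriv 0 g r := by
      intro r hr
      have h1 := (hd 0 r hr).unique (by
        simpa only [iteratedDeriv_zero] using (hq r).rpow_const (p := -lam) (Or.inl hr.ne'))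
      rw [zero_add] at h1
      rw [h1, iteratedDeriv_zero, hg]
      simp only
      rw [Real.rpow_sub_one hr.ne']
      field_simp
    have h1 := hderiv h0 (fun r hr => (hq r).mul (hd 1 r hr))
      (fun r hr => (((hx r).const_mul (2 * lam)).mul (hd 0 r hr)))
    intro r hr
    have := h1 r hr
    simp only [Nat.cast_zero, zero_add, Nat.reduceAdd] at this ⊢
    linear_combination this
  | succ n ih =>
    have h1 := hderiv ih (fun r hr => (hq r).mul (hd (n + 2) r hr))
      (fun r hr => (((hx r).const_mul (2 * (n + 1 + lam))).mul (hd (n + 1) r hr)).sub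
        ((hd n r hr).const_mul ((n + 1) * (n + 2 * lam))))
    intro r hr
    have := h1 r hr
    push_cast
    linear_combination this

lemma gegenbauer_recurrence {lam : ℝ} (h : lam ≠ 0) (n : ℕ) (x : ℝ) :
    (n + 2) * gegenbauer lam (n + 2) x =
      2 * (n + 1 + lam) * x * gegenbauer lam (n + 1) x - (n + 2 * lam) * gegenbauer lam n x := by
  have h1 := iteratedDeriv_genFun lam x n 0 (by norm_num)
  simp only [gegenbauer, if_neg h, Nat.factorial_succ]
  push_cast
  have : (n.factorial : ℝ) ≠ 0 := by positivity
  have h3 : (n : ℝ) + 1 ≠ 0 := by positivity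
  have h4 : (n : ℝ) + 1 + 1 ≠ 0 := by positivity
  field_simp
  linear_combination (n + 2) * h1

lemma gegenbauer_zero {lam : ℝ} (h : lam ≠ 0) (x : ℝ) : gegenbauer lam 0 x = 1 := by
  simp [gegenbauer, h]

lemma gegenbauer_one {lam : ℝ} (h : lam ≠ 0) (x : ℝ) : gegenbauer lam 1 x = 2 * lam * x := by
  have := (((hasDerivAt_id (0 : ℝ)).const_mul (2 * x)).const_sub 1).add ((hasDerivAt_id 0).pow 2)
  have h2 := HasDerivAt.rpow_const (p := -lam) this (Or.inl (by simp))
  simp only [gegenbauer, if_neg h, iteratedDeriv_one, Nat.factorial_one, Nat.cast_one, div_one]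
  refine h2.deriv.trans ?_
  simp; ring

lemma gegenbauer_apply_one {lam : ℝ} (h : lam ≠ 0) : ∀ n : ℕ,
    (n + 1) * gegenbauer lam (n + 1) 1 = (n + 2 * lam) * gegenbauer lam n 1
  | 0 => by simp [gegenbauer_zero h, gegenbauer_one h]
  | n + 1 => by
    have h1 := gegenbauer_apply_one h n
    have h2 := gegenbauer_recurrence h n 1
    push_cast
    linear_combination h2 + h1

lemma gegenbauer_apply_one_pos {lam : ℝ} (h : 0 < lam) : ∀ n : ℕ, 0 < gegenbauer lam n 1
  | 0 => by simp [gegenbauer_zero h.ne']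
  | n + 1 => by
    have h1 := gegenbauer_apply_one h.ne' n
    have h2 := gegenbauer_apply_one_pos h n
    have h3 : 0 < (n + 2 * lam) * gegenbauer lam n 1 := by positivity
    rw [← h1] at h3
    exact pos_of_mul_pos_right h3 (by positivity)

lemma gegenbauer_eq_gegPoly {d : ℕ} (hd : 2 ≤ d) (x : ℝ) : ∀ n : ℕ,
    gegenbauer (((d : ℝ) - 1) / 2) n x =
      gegenbauer (((d : ℝ) - 1) / 2) n 1 * (gegPoly d n).eval x := by
  have h2 : (2 : ℝ) ≤ d := by exact_mod_cast hd
  have h : ((d : ℝ) - 1) / 2 ≠ 0 := by linarith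
  intro n
  induction n using Nat.twoStepInduction with
  | zero => simp [gegenbauer_zero h, gegPoly]
  | one => simp [gegenbauer_one h, gegPoly]
  | more n ih0 ih1 =>
    have r1 := gegenbauer_recurrence h n x
    have r2 := gegenbauer_apply_one h n
    have r3 := gegenbauer_apply_one h (n + 1)
    have r4 := gegPoly_eval_recurrence (show 1 ≤ d by omega) n x
    push_cast at r3
    rw [ih0, ih1] at r1
    have hn : (n + 2 : ℝ) ≠ 0 := by positivity
    apply mul_left_cancel₀ hn
    linear_combination r1 + (eval x (gegPoly d n)) * r2 - (eval x (gegPoly d (n + 2))) * r3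
      - (gegenbauer (((d : ℝ) - 1) / 2) (n + 1) 1) * r4

/-- For `d = 1` the recurrence has the common factor `n + 1`, and cancelling it leaves the Chebyshev
recurrence. -/
lemma chebyshev_eq_gegPoly (x : ℝ) (n : ℕ) :
    (Chebyshev.T ℝ (n : ℤ)).eval x = (gegPoly 1 n).eval x := by
  induction n using Nat.twoStepInduction with
  | zero => simp [gegPoly]
  | one => simp [gegPoly]
  | more n ih0 ih1 =>
    have r4 := gegPoly_eval_recurrence le_rfl n x
    have hn : (n + 1 : ℝ) ≠ 0 := by positivity
    apply mul_left_cancel₀ hn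
    push_cast at r4 ih1 ⊢
    rw [Chebyshev.T_add_two]
    simp only [eval_sub, eval_mul, eval_X, eval_ofNat, ih0, ih1]
    linear_combination -r4

lemma normGegenbauer_eq_gegPoly {d : ℕ} (hd : 1 ≤ d) (n : ℕ) (x : ℝ) :
    normGegenbauer n d x = (gegPoly d n).eval x := by
  rcases hd.eq_or_lt with rfl | hd
  · simp [normGegenbauer, gegenbauer, chebyshev_eq_gegPoly]
  · have h2 : (2 : ℝ) ≤ d := by exact_mod_cast hd
    have := (gegenbauer_apply_one_pos (lam := ((d : ℝ) - 1) / 2) (by linarith) n).ne'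
    rw [normGegenbauer, gegenbauer_eq_gegPoly hd x n, mul_div_cancel_left₀ _ this]

/-! ### Convolution and positive definiteness on the sphere -/

section

variable {E : Type*} [NormedAddCommGroup E] [InnerProductSpace ℝ E] [FiniteDimensional ℝ E]
  [MeasurableSpace E] [BorelSpace E]

lemma sphereMeasure_univ_pos [Nontrivial E] : 0 < (sphereMeasure E).real Set.univ := by
  have : NeZero (sphereMeasure E) := ⟨Measure.toSphere_ne_zero _⟩
  exact measureReal_univ_pos

lemma zonalFunctional_one (e : E) : zonalFunctional e 1 = (sphereMeasure E).real Set.univ := by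
  simp [zonalFunctional_apply]

lemma integrable_sphere_prod_of_continuous {F : Type*} [NormedAddCommGroup F]
    {f : Metric.sphere (0 : E) 1 × Metric.sphere (0 : E) 1 → F} (hf : Continuous f) :
    Integrable f ((sphereMeasure E).prod (sphereMeasure E)) := by
  rw [← integrableOn_univ]
  exact hf.continuousOn.integrableOn_compact isCompact_univ

/-- The zonal Gegenbauer polynomials are, up to a positive factor, idempotent under convolution on
the sphere. -/
lemma gegPoly_convolution {d : ℕ} (hd : 1 ≤ d) (hE : Module.finrank ℝ E = d + 1) (n : ℕ) :
    ∃ α : ℝ, 0 < α ∧ ∀ ξ η : E, ‖ξ‖ = 1 → ‖η‖ = 1 →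
      ∫ ζ : Metric.sphere (0 : E) 1,
        (gegPoly d n).eval (inner ℝ ξ (ζ : E)) * (gegPoly d n).eval (inner ℝ η (ζ : E))
          ∂sphereMeasure E = α * (gegPoly d n).eval (inner ℝ ξ η) := by
  have : Nontrivial E := Module.nontrivial_of_finrank_pos (R := ℝ) (by omega)
  obtain ⟨e, he⟩ := exists_norm_eq E (zero_le_one (α := ℝ))
  have hL := isGegFunctional_zonalFunctional hd hE he
  have hL1 : 0 < zonalFunctional e 1 := by
    rw [zonalFunctional_one]; exact sphereMeasure_univ_pos
  obtain ⟨r, hr, h⟩ := exists_poly_sphere_integral (E := E) (gegPoly_natDegree_le d n)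
    (gegPoly_natDegree_le d n)
  rw [min_self] at hr
  -- By Fubini, testing `c_n * c_n` against `c_j` is testing `c_n * c_j` against `c_n`. The degree
  -- of `c_n * c_j` is at most `j < n`, so the result is zero.
  have hzero : ∀ j < n, zonalFunctional e (r * gegPoly d j) = 0 := by
    intro j hj
    obtain ⟨s, hs, h'⟩ := exists_poly_sphere_integral (E := E) (gegPoly_natDegree_le d n)
      (gegPoly_natDegree_le d j)
    have hs0 : zonalFunctional e (s * gegPoly d n) = 0 :=
      hL.map_mul_gegPoly_of_natDegree_lt hd (hs.trans_lt (by omega))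
    rw [← hs0, zonalFunctional_apply, zonalFunctional_apply]
    have e1 : ∀ η : Metric.sphere (0 : E) 1, (r * gegPoly d j).eval (inner ℝ e (η : E)) =
        ∫ ζ : Metric.sphere (0 : E) 1, (gegPoly d n).eval (inner ℝ e (ζ : E)) *
          (gegPoly d n).eval (inner ℝ (η : E) (ζ : E)) * (gegPoly d j).eval (inner ℝ e (η : E))
            ∂sphereMeasure E := by
      intro η
      rw [integral_mul_const, h e η he (by simp), eval_mul]
    have e2 : ∀ ζ : Metric.sphere (0 : E) 1, (s * gegPoly d n).eval (inner ℝ e (ζ : E)) =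
        ∫ η : Metric.sphere (0 : E) 1, (gegPoly d n).eval (inner ℝ e (ζ : E)) *
          (gegPoly d n).eval (inner ℝ (η : E) (ζ : E)) * (gegPoly d j).eval (inner ℝ e (η : E))
            ∂sphereMeasure E := by
      intro ζ
      simp only [mul_assoc]
      rw [integral_const_mul, eval_mul, mul_comm, real_inner_comm (ζ : E) e,
        ← h' ζ e (by simp) he]
      simp only [real_inner_comm]
    simp only [e1, e2]
    refine integral_integral_swap (integrable_sphere_prod_of_continuous ?_)
    simp only [Function.uncurry_def]
    fun_prop
  set α := harmonicDim n d / zonalFunctional e 1 * zonalFunctional e (r * gegPoly d n)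
  have hr' : r = α • gegPoly d n := by
    rw [hL.expansion hd hL1.ne' hr, Finset.sum_range_succ, Finset.sum_eq_zero, zero_add]
    intro j hj
    rw [hzero j (Finset.mem_range.1 hj), mul_zero, zero_smul]
  have hα : ∀ ξ η : E, ‖ξ‖ = 1 → ‖η‖ = 1 →
      ∫ ζ : Metric.sphere (0 : E) 1,
        (gegPoly d n).eval (inner ℝ ξ (ζ : E)) * (gegPoly d n).eval (inner ℝ η (ζ : E))
          ∂sphereMeasure E = α * (gegPoly d n).eval (inner ℝ ξ η) := by
    intro ξ η hξ hη
    rw [h ξ η hξ hη, hr', eval_smul, smul_eq_mul]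
  refine ⟨α, ?_, hα⟩
  -- On the diagonal, `α = L(c_n²) = L(1) / N_n(d)`, which is positive.
  have h1 := hα e e he he
  rw [real_inner_self_eq_norm_sq, he, one_pow, gegPoly_eval_one hd, mul_one] at h1
  have h2 := hL.map_gegPoly_sq hd n
  rw [zonalFunctional_apply] at h2
  simp only [eval_mul] at h2
  rw [h1] at h2
  rw [← h2] at hL1
  exact pos_of_mul_pos_right hL1 (harmonicDim_pos hd n).le

/-- The normalized Gegenbauer polynomials are positive definite on the sphere. -/
lemma gegPoly_posSemidef {d : ℕ} (hd : 1 ≤ d) (hE : Module.finrank ℝ E = d + 1) (n : ℕ)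
    {ι : Type*} [Fintype ι] (ξ : ι → Metric.sphere (0 : E) 1) :
    (Matrix.of fun k l : ι =>
      (((gegPoly d n).eval (inner ℝ (ξ k : E) (ξ l : E)) : ℝ) : ℂ)).PosSemidef := by
  obtain ⟨α, hα, h⟩ := gegPoly_convolution (E := E) hd hE n
  refine Matrix.PosSemidef.of_dotProduct_mulVec_nonneg ?_ fun z => ?_
  · ext k l
    simp [Matrix.conjTranspose_apply, real_inner_comm]
  · set c : ι → Metric.sphere (0 : E) 1 → ℝ := fun k ζ =>
      (gegPoly d n).eval (inner ℝ (ξ k : E) (ζ : E)) with hc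
    have hcc : ∀ k, Continuous (c k) := fun k => by simp only [hc]; fun_prop
    have key : star z ⬝ᵥ ((Matrix.of fun k l : ι =>
        (((gegPoly d n).eval (inner ℝ (ξ k : E) (ξ l : E)) : ℝ) : ℂ)).mulVec z) =
        ((α⁻¹ * ∫ ζ, ‖∑ k, z k * c k ζ‖ ^ 2 ∂sphereMeasure E : ℝ) : ℂ) := by
      have e1 : ∀ ζ, ((‖∑ k, z k * c k ζ‖ ^ 2 : ℝ) : ℂ) =
          ∑ k, ∑ l, star (z k) * z l * ((c k ζ * c l ζ : ℝ) : ℂ) := by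
        intro ζ
        rw [Complex.ofReal_pow, ← Complex.conj_mul', map_sum, Finset.sum_mul_sum]
        refine Finset.sum_congr rfl fun k _ => Finset.sum_congr rfl fun l _ => ?_
        simp only [map_mul, Complex.conj_ofReal, Complex.ofReal_mul, Complex.star_def]
        ring
      rw [Complex.ofReal_mul, ← integral_complex_ofReal]
      simp only [e1]
      rw [integral_finsetSum _ fun k _ => integrable_sphere_of_continuous (by fun_prop)]
      rw [Finset.mul_sum, dotProduct]
      refine Finset.sum_congr rfl fun k _ => ?_
      rw [integral_finsetSum _ fun l _ => integrable_sphere_of_continuous (by fun_prop)]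
      rw [Matrix.mulVec, dotProduct, Finset.mul_sum, Finset.mul_sum]
      refine Finset.sum_congr rfl fun l _ => ?_
      rw [integral_const_mul, integral_complex_ofReal, h _ _ (by simp) (by simp)]
      have : (α : ℂ) ≠ 0 := by exact_mod_cast hα.ne'
      simp only [Matrix.of_apply, Pi.star_apply]
      push_cast
      field_simp
    rw [key]
    have : 0 ≤ α⁻¹ * ∫ ζ, ‖∑ k, z k * c k ζ‖ ^ 2 ∂sphereMeasure E :=
      mul_nonneg (inv_nonneg.2 hα.le) (integral_nonneg fun _ => by positivity)
    exact_mod_cast this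

lemma integral_simpleFunc_comp {α β F : Type*} [MeasurableSpace α] [NormedAddCommGroup F]
    [NormedSpace ℝ F] [CompleteSpace F] {μ : Measure α} [IsFiniteMeasure μ]
    (s : SimpleFunc α β) (g : β → F) :
    ∫ x, g (s x) ∂μ = ∑ b ∈ s.range, μ.real (s ⁻¹' {b}) • g b := by
  classical
  have e : ∀ x, g (s x) = ∑ b ∈ s.range, (s ⁻¹' {b}).indicator (fun _ => g b) x := by
    intro x
    rw [Finset.sum_eq_single (s x)]
    · simp
    · intro b _ hb
      simp [hb.symm]
    · intro h; simp at h
  simp only [e]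
  rw [integral_finsetSum]
  · refine Finset.sum_congr rfl fun b _ => ?_
    rw [integral_indicator_const _ (s.measurableSet_fiber b)]
  · intro b _
    exact (integrable_const _).indicator (s.measurableSet_fiber b)

/-- The double integral of a continuous positive definite kernel is nonnegative. -/
lemma double_integral_nonneg [Nontrivial E]
    {K : Metric.sphere (0 : E) 1 → Metric.sphere (0 : E) 1 → ℂ}
    (hK : Continuous (Function.uncurry K))
    (hpos : ∀ (t : Finset (Metric.sphere (0 : E) 1)) (a : Metric.sphere (0 : E) 1 → ℝ),
      0 ≤ ∑ ξ ∈ t, ∑ η ∈ t, (a ξ : ℂ) * a η * K ξ η) :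
    0 ≤ ∫ ξ, ∫ η, K ξ η ∂sphereMeasure E ∂sphereMeasure E := by
  have : Nonempty (Metric.sphere (0 : E) 1) := by
    obtain ⟨e, he⟩ := exists_norm_eq E (zero_le_one (α := ℝ))
    exact ⟨⟨e, by simpa using he⟩⟩
  obtain ⟨C, hC⟩ : ∃ C, ∀ p, ‖Function.uncurry K p‖ ≤ C := by
    obtain ⟨C, hC⟩ := isCompact_univ.exists_bound_of_continuousOn hK.continuousOn
    exact ⟨C, fun p => hC p trivial⟩
  -- Simple functions tending to the identity. The double integral of `K (s N ξ) (s N η)` is a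
  -- finite quadratic form whose weights are the measures of the fibres of `s N`.
  set s : ℕ → SimpleFunc (Metric.sphere (0 : E) 1) (Metric.sphere (0 : E) 1) :=
    SimpleFunc.nearestPt (TopologicalSpace.denseSeq _)
  have hs : ∀ x, Filter.Tendsto (fun N => s N x) Filter.atTop (nhds x) := fun x =>
    SimpleFunc.tendsto_nearestPt (by
      rw [(TopologicalSpace.denseRange_denseSeq _).closure_range]; trivial)
  have hlim : Filter.Tendsto (fun N => ∫ p, Function.uncurry K (s N p.1, s N p.2)
      ∂(sphereMeasure E).prod (sphereMeasure E)) Filter.atTop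
      (nhds (∫ p, Function.uncurry K p ∂(sphereMeasure E).prod (sphereMeasure E))) := by
    refine tendsto_integral_of_dominated_convergence (fun _ => C) ?_ (integrable_const _) ?_ ?_
    · intro N
      exact (hK.measurable.comp (((s N).measurable.comp measurable_fst).prodMk
        ((s N).measurable.comp measurable_snd))).aestronglyMeasurable
    · exact fun N => .of_forall fun p => hC _
    · exact .of_forall fun p => (hK.tendsto p).comp ((hs p.1).prodMk_nhds (hs p.2))
  rw [integral_prod _ (integrable_sphere_prod_of_continuous hK)] at hlim
  refine ge_of_tendsto hlim (.of_forall fun N => ?_)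
  rw [integral_prod]
  · simp only [Function.uncurry_apply_pair]
    have e1 : ∀ x, ∫ y, K (s N x) (s N y) ∂sphereMeasure E =
        ∑ η ∈ (s N).range, (sphereMeasure E).real (s N ⁻¹' {η}) • K (s N x) η := fun x =>
      integral_simpleFunc_comp (s N) (K (s N x))
    simp only [e1]
    rw [integral_simpleFunc_comp (s N) fun ξ =>
      ∑ η ∈ (s N).range, (sphereMeasure E).real (s N ⁻¹' {η}) • K ξ η]
    have := hpos (s N).range fun ξ => (sphereMeasure E).real (s N ⁻¹' {ξ})
    convert this using 2 with ξ _
    rw [Finset.smul_sum]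
    refine Finset.sum_congr rfl fun η _ => ?_
    rw [Complex.real_smul, Complex.real_smul, mul_assoc]
  · refine Integrable.mono' (integrable_const C) ?_ (.of_forall fun p => hC _)
    exact (hK.measurable.comp (((s N).measurable.comp measurable_fst).prodMk
        ((s N).measurable.comp measurable_snd))).aestronglyMeasurable

end

/-! ### Angular integration and the zonal integration formula -/

/-- Integration over `[0, π]` against the weight `sin θ ^ (d - 1)`. -/
def angularFunctional (d : ℕ) : ℝ[X] →ₗ[ℝ] ℝ where
  toFun p := ∫ θ in (0 : ℝ)..Real.pi, p.eval (Real.cos θ) * Real.sin θ ^ (d - 1)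
  map_add' p q := by
    simp only [eval_add, add_mul]
    exact intervalIntegral.integral_add (Continuous.intervalIntegrable (by fun_prop) _ _)
      (Continuous.intervalIntegrable (by fun_prop) _ _)
  map_smul' a p := by
    simp only [eval_smul, smul_eq_mul, RingHom.id_apply, mul_assoc]
    exact intervalIntegral.integral_const_mul _ _

lemma angularFunctional_apply (d : ℕ) (p : ℝ[X]) : angularFunctional d p =
    ∫ θ in (0 : ℝ)..Real.pi, p.eval (Real.cos θ) * Real.sin θ ^ (d - 1) := rfl

lemma angularFunctional_one (d : ℕ) :
    angularFunctional d 1 = ∫ θ in (0 : ℝ)..Real.pi, Real.sin θ ^ (d - 1) := by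
  simp [angularFunctional_apply]

lemma angularFunctional_one_pos (d : ℕ) : 0 < angularFunctional d 1 := by
  rw [angularFunctional_one]; exact integral_sin_pow_pos _

/-- The integrand is the derivative of `-sin^d θ q(cos θ)`, which vanishes at both endpoints because
`d ≥ 1`. -/
lemma isGegFunctional_angularFunctional {d : ℕ} (hd : 1 ≤ d) :
    IsGegFunctional d (angularFunctional d) := by
  obtain ⟨d, rfl⟩ : ∃ k, d = k + 1 := ⟨d - 1, by omega⟩
  intro q
  have h : ∀ θ ∈ Set.uIcc 0 Real.pi, HasDerivAt
      (fun θ => -(Real.sin θ ^ (d + 1) * q.eval (Real.cos θ)))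
      (((1 - X ^ 2) * derivative q - ((d + 1 : ℕ) : ℝ[X]) * (X * q)).eval (Real.cos θ)
        * Real.sin θ ^ d) θ := by
    intro θ _
    have h1 := (((Real.hasDerivAt_sin θ).pow (d + 1)).mul
      ((q.hasDerivAt (Real.cos θ)).comp θ (Real.hasDerivAt_cos θ))).neg
    refine h1.congr_deriv ?_
    have h2 : (1 : ℝ) - Real.cos θ ^ 2 = Real.sin θ ^ 2 := by
      linarith [Real.sin_sq_add_cos_sq θ]
    simp only [eval_sub, eval_mul, eval_one, eval_pow, eval_X, eval_natCast, h2, Pi.pow_apply,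
      Function.comp_apply, Nat.add_sub_cancel]
    ring
  rw [angularFunctional_apply, Nat.add_sub_cancel,
    intervalIntegral.integral_eq_sub_of_hasDerivAt h
      (Continuous.intervalIntegrable (by fun_prop) _ _)]
  simp

lemma sin_pow_nonneg_of_mem {θ : ℝ} (h : θ ∈ Set.Icc 0 Real.pi) (k : ℕ) : 0 ≤ Real.sin θ ^ k :=
  pow_nonneg (Real.sin_nonneg_of_nonneg_of_le_pi h.1 h.2) _

lemma angularFunctional_mono {d : ℕ} {p q : ℝ[X]}
    (h : ∀ x ∈ Set.Icc (-1 : ℝ) 1, p.eval x ≤ q.eval x) :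
    angularFunctional d p ≤ angularFunctional d q := by
  rw [angularFunctional_apply, angularFunctional_apply]
  refine intervalIntegral.integral_mono_on Real.pi_pos.le
    (Continuous.intervalIntegrable (by fun_prop) _ _)
    (Continuous.intervalIntegrable (by fun_prop) _ _) fun θ hθ => ?_
  exact mul_le_mul_of_nonneg_right (h _ (Real.cos_mem_Icc θ)) (sin_pow_nonneg_of_mem hθ _)

/-- Zonal integration formula, real-valued version. -/
lemma zonal_integral_real {E : Type*} [NormedAddCommGroup E] [InnerProductSpace ℝ E]
    [FiniteDimensional ℝ E] [MeasurableSpace E] [BorelSpace E] {d : ℕ} (hd : 1 ≤ d)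
    (hE : Module.finrank ℝ E = d + 1) {e : E} (he : ‖e‖ = 1) {F : ℝ → ℝ} (hF : Continuous F) :
    angularFunctional d 1 * ∫ ζ : Metric.sphere (0 : E) 1, F (inner ℝ e (ζ : E)) ∂sphereMeasure E =
      (sphereMeasure E).real Set.univ *
        ∫ θ in (0 : ℝ)..Real.pi, F (Real.cos θ) * Real.sin θ ^ (d - 1) := by
  have : Nontrivial E := Module.nontrivial_of_finrank_pos (R := ℝ) (by omega)
  set A := angularFunctional d 1
  set S := (sphereMeasure E).real Set.univ
  have hAi : A = ∫ θ in (0 : ℝ)..Real.pi, Real.sin θ ^ (d - 1) := angularFunctional_one d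
  have hA0 : 0 < A := angularFunctional_one_pos d
  have hS0 : 0 < S := sphereMeasure_univ_pos
  refine eq_of_abs_sub_le_all fun ε hε => ?_
  -- Approximation within `δ` costs `δ S A` on each side, hence `2 A S` in the denominator. For
  -- polynomials the formula is the proportionality of the two functionals.
  obtain ⟨δ, hδ⟩ : ∃ δ, δ = ε / (2 * A * S) := ⟨_, rfl⟩
  obtain ⟨p, hp⟩ := exists_polynomial_near_of_continuousOn (-1) 1 F hF.continuousOn
    δ (by rw [hδ]; positivity)
  have hpoly : A * zonalFunctional e p = S * angularFunctional d p := by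
    have := (isGegFunctional_angularFunctional hd).proportional hd
      (isGegFunctional_zonalFunctional hd hE he) p
    rwa [zonalFunctional_one] at this
  have h1 : |(∫ ζ : Metric.sphere (0 : E) 1, F (inner ℝ e (ζ : E)) ∂sphereMeasure E) -
      zonalFunctional e p| ≤ δ * S := by
    rw [zonalFunctional_apply, ← integral_sub (integrable_sphere_of_continuous (by fun_prop))
      (integrable_sphere_of_continuous (by fun_prop)), ← Real.norm_eq_abs]
    refine norm_integral_le_of_norm_le_const (.of_forall fun ζ => ?_)
    rw [Real.norm_eq_abs, abs_sub_comm]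
    refine (hp _ ?_).le
    rw [Set.mem_Icc, ← abs_le]
    have := abs_real_inner_le_norm e (ζ : E)
    simpa [he] using this
  have h2 : |(∫ θ in (0 : ℝ)..Real.pi, F (Real.cos θ) * Real.sin θ ^ (d - 1)) -
      angularFunctional d p| ≤ δ * A := by
    rw [angularFunctional_apply, ← intervalIntegral.integral_sub
      (Continuous.intervalIntegrable (by fun_prop) _ _)
      (Continuous.intervalIntegrable (by fun_prop) _ _), hAi, ← intervalIntegral.integral_const_mul]
    refine (intervalIntegral.abs_integral_le_integral_abs Real.pi_pos.le).trans
      (intervalIntegral.integral_mono_on Real.pi_pos.le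
        (Continuous.intervalIntegrable (by fun_prop) _ _)
        (Continuous.intervalIntegrable (by fun_prop) _ _) fun θ hθ => ?_)
    rw [← sub_mul, abs_mul, abs_of_nonneg (sin_pow_nonneg_of_mem hθ _), abs_sub_comm]
    exact mul_le_mul_of_nonneg_right (hp _ (Real.cos_mem_Icc θ)).le (sin_pow_nonneg_of_mem hθ _)
  set U := ∫ ζ : Metric.sphere (0 : E) 1, F (inner ℝ e (ζ : E)) ∂sphereMeasure E
  set V := ∫ θ in (0 : ℝ)..Real.pi, F (Real.cos θ) * Real.sin θ ^ (d - 1)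
  have h3 : A * U - S * V = A * (U - zonalFunctional e p) - S * (V - angularFunctional d p) := by
    linear_combination hpoly
  rw [h3]
  calc _ ≤ |A * (U - zonalFunctional e p)| + |S * (V - angularFunctional d p)| := abs_sub _ _
    _ ≤ A * (δ * S) + S * (δ * A) := by
      rw [abs_mul, abs_mul, abs_of_pos hA0, abs_of_pos hS0]
      gcongr
    _ = ε := by rw [hδ]; field_simp; ring

/-- The weighted integral `∫ H(θ) sin θ ^ (d - 1) dθ` over `[0, π]`. -/
def angularIntegral (d : ℕ) (H : ℝ → ℂ) : ℂ :=
  ∫ θ in (0 : ℝ)..Real.pi, H θ * ((Real.sin θ ^ (d - 1) : ℝ) : ℂ)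

lemma intervalIntegrable_angular (d : ℕ) {H : ℝ → ℂ} (hH : Continuous H) :
    IntervalIntegrable (fun θ => H θ * ((Real.sin θ ^ (d - 1) : ℝ) : ℂ)) volume 0 Real.pi :=
  Continuous.intervalIntegrable (by fun_prop) _ _

lemma angularIntegral_sub (d : ℕ) {H K : ℝ → ℂ} (hH : Continuous H) (hK : Continuous K) :
    angularIntegral d (fun θ => H θ - K θ) = angularIntegral d H - angularIntegral d K := by
  simp only [angularIntegral, sub_mul]
  exact intervalIntegral.integral_sub (intervalIntegrable_angular d hH)
    (intervalIntegrable_angular d hK)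

lemma angularIntegral_const_mul (d : ℕ) (a : ℂ) (H : ℝ → ℂ) :
    angularIntegral d (fun θ => a * H θ) = a * angularIntegral d H := by
  simp only [angularIntegral, mul_assoc]
  exact intervalIntegral.integral_const_mul _ _

lemma angularIntegral_finsetSum (d : ℕ) {ι : Type*} (s : Finset ι) {H : ι → ℝ → ℂ}
    (hH : ∀ i ∈ s, Continuous (H i)) :
    angularIntegral d (fun θ => ∑ i ∈ s, H i θ) = ∑ i ∈ s, angularIntegral d (H i) := by
  simp only [angularIntegral, Finset.sum_mul]
  exact intervalIntegral.integral_finsetSum fun i hi => intervalIntegrable_angular d (hH i hi)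

lemma angularIntegral_poly (d : ℕ) (p : ℝ[X]) :
    angularIntegral d (fun θ => ((p.eval (Real.cos θ) : ℝ) : ℂ)) = (angularFunctional d p : ℂ) := by
  rw [angularIntegral, angularFunctional_apply, ← intervalIntegral.integral_ofReal]
  simp

lemma norm_angularIntegral_le (d : ℕ) {H : ℝ → ℂ} {C : ℝ}
    (hC : ∀ θ ∈ Set.Icc 0 Real.pi, ‖H θ‖ ≤ C) :
    ‖angularIntegral d H‖ ≤ C * angularFunctional d 1 := by
  rw [angularIntegral, angularFunctional_one, ← intervalIntegral.integral_const_mul]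
  refine intervalIntegral.norm_integral_le_of_norm_le Real.pi_pos.le
    (.of_forall fun θ hθ => ?_) (Continuous.intervalIntegrable (by fun_prop) _ _)
  have hθ' : θ ∈ Set.Icc 0 Real.pi := ⟨hθ.1.le, hθ.2⟩
  rw [norm_mul, Complex.norm_real, Real.norm_eq_abs, abs_of_nonneg (sin_pow_nonneg_of_mem hθ' _)]
  exact mul_le_mul_of_nonneg_right (hC θ hθ') (sin_pow_nonneg_of_mem hθ' _)

/-- Zonal integration formula. -/
lemma zonal_integral {E : Type*} [NormedAddCommGroup E] [InnerProductSpace ℝ E]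
    [FiniteDimensional ℝ E] [MeasurableSpace E] [BorelSpace E] {d : ℕ} (hd : 1 ≤ d)
    (hE : Module.finrank ℝ E = d + 1) {e : E} (he : ‖e‖ = 1) {F : ℝ → ℂ} (hF : Continuous F) :
    (angularFunctional d 1 : ℂ) *
        ∫ ζ : Metric.sphere (0 : E) 1, F (inner ℝ e (ζ : E)) ∂sphereMeasure E =
      ((sphereMeasure E).real Set.univ : ℂ) * angularIntegral d fun θ => F (Real.cos θ) := by
  have hre := zonal_integral_real hd hE he (F := fun x => (F x).re) (by fun_prop)
  have him := zonal_integral_real hd hE he (F := fun x => (F x).im) (by fun_prop)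
  have i1 : Integrable (fun ζ : Metric.sphere (0 : E) 1 => F (inner ℝ e (ζ : E)))
    (sphereMeasure E) := integrable_sphere_of_continuous (by fun_prop)
  have i2 := intervalIntegrable_angular d (H := fun θ => F (Real.cos θ)) (by fun_prop)
  have e1 : (angularIntegral d fun θ => F (Real.cos θ)).re =
      ∫ θ in (0 : ℝ)..Real.pi, (F (Real.cos θ)).re * Real.sin θ ^ (d - 1) := by
    rw [angularIntegral, intervalIntegral.integral_of_le Real.pi_pos.le,
      intervalIntegral.integral_of_le Real.pi_pos.le]
    refine (integral_re i2.1).symm.trans ?_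
    simp only [RCLike.re_to_complex, Complex.re_mul_ofReal]
  have e2 : (angularIntegral d fun θ => F (Real.cos θ)).im =
      ∫ θ in (0 : ℝ)..Real.pi, (F (Real.cos θ)).im * Real.sin θ ^ (d - 1) := by
    rw [angularIntegral, intervalIntegral.integral_of_le Real.pi_pos.le,
      intervalIntegral.integral_of_le Real.pi_pos.le]
    refine (integral_im i2.1).symm.trans ?_
    simp only [RCLike.im_to_complex, Complex.im_mul_ofReal]
  have e3 := integral_re i1
  have e4 := integral_im i1
  simp only [RCLike.re_to_complex, RCLike.im_to_complex] at e3 e4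
  apply Complex.ext
  · rw [Complex.re_ofReal_mul, Complex.re_ofReal_mul, ← e3, e1]
    exact hre
  · rw [Complex.im_ofReal_mul, Complex.im_ofReal_mul, ← e4, e2]
    exact him

lemma nonneg_of_ofReal_mul_nonneg {a : ℝ} (ha : 0 < a) {z : ℂ} (h : 0 ≤ (a : ℂ) * z) : 0 ≤ z := by
  rw [Complex.le_def] at h ⊢
  simp only [Complex.zero_re, Complex.re_ofReal_mul, Complex.zero_im, Complex.im_ofReal_mul] at h ⊢
  refine ⟨nonneg_of_mul_nonneg_right h.1 ha, ?_⟩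
  have := h.2.symm
  rw [mul_eq_zero] at this
  exact (this.resolve_left ha.ne').symm

/-- A continuous function whose zonal kernel is positive definite on the sphere has nonnegative
weighted integral. -/
lemma angularIntegral_nonneg {E : Type*} [NormedAddCommGroup E] [InnerProductSpace ℝ E]
    [FiniteDimensional ℝ E] [MeasurableSpace E] [BorelSpace E] {d : ℕ} (hd : 1 ≤ d)
    (hE : Module.finrank ℝ E = d + 1) {F : ℝ → ℂ} (hF : Continuous F)
    (hpos : ∀ (t : Finset (Metric.sphere (0 : E) 1)) (a : Metric.sphere (0 : E) 1 → ℝ),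
      0 ≤ ∑ ξ ∈ t, ∑ η ∈ t, (a ξ : ℂ) * a η * F (inner ℝ (ξ : E) (η : E))) :
    0 ≤ angularIntegral d fun θ => F (Real.cos θ) := by
  have : Nontrivial E := Module.nontrivial_of_finrank_pos (R := ℝ) (by omega)
  set K : Metric.sphere (0 : E) 1 → Metric.sphere (0 : E) 1 → ℂ :=
    fun ξ η => F (inner ℝ (ξ : E) (η : E)) with hKdef
  have hK : Continuous (Function.uncurry K) := by
    simp only [hKdef, Function.uncurry_def]; fun_prop
  have h := double_integral_nonneg (K := K) hK fun t a => hpos t a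
  simp only [hKdef] at h
  have hA : (0 : ℝ) < angularFunctional d 1 := angularFunctional_one_pos d
  have hS : (0 : ℝ) < (sphereMeasure E).real Set.univ := sphereMeasure_univ_pos
  have hAc : (angularFunctional d 1 : ℂ) ≠ 0 := by exact_mod_cast hA.ne'
  -- The inner integral does not depend on `ξ`, so the double integral is a positive multiple of the
  -- angular integral.
  have e : ∀ ξ : Metric.sphere (0 : E) 1,
      ∫ η : Metric.sphere (0 : E) 1, F (inner ℝ (ξ : E) (η : E)) ∂sphereMeasure E =
      (((sphereMeasure E).real Set.univ / angularFunctional d 1 : ℝ) : ℂ) *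
        angularIntegral d fun θ => F (Real.cos θ) := by
    intro ξ
    have := zonal_integral hd hE (e := (ξ : E)) (by simp) hF
    apply mul_left_cancel₀ hAc
    rw [this]
    push_cast
    field_simp
  simp only [e] at h
  rw [integral_const, Complex.real_smul, ← mul_assoc, ← Complex.ofReal_mul] at h
  exact nonneg_of_ofReal_mul_nonneg (by positivity) h

lemma cos_image_Ioo : Real.cos '' Set.Ioo 0 Real.pi = Set.Ioo (-1) 1 := by
  ext x
  constructor
  · rintro ⟨θ, hθ, rfl⟩
    have h1 := Real.strictAntiOn_cos (Set.left_mem_Icc.2 Real.pi_pos.le)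
      (Set.Ioo_subset_Icc_self hθ) hθ.1
    have h2 := Real.strictAntiOn_cos (Set.Ioo_subset_Icc_self hθ)
      (Set.right_mem_Icc.2 Real.pi_pos.le) hθ.2
    rw [Real.cos_zero] at h1
    rw [Real.cos_pi] at h2
    exact ⟨h2, h1⟩
  · rintro ⟨h1, h2⟩
    refine ⟨Real.arccos x, ⟨Real.arccos_pos.2 h2, ?_⟩, Real.cos_arccos h1.le h2.le⟩
    refine lt_of_le_of_ne (Real.arccos_le_pi x) fun h => ?_
    rw [Real.arccos_eq_pi] at h
    linarith

/-- The substitution `x = cos θ` in an integral against the weight `(1 - x²)^(d/2 - 1)`. -/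
lemma integral_weight_eq_angularIntegral {d : ℕ} (hd : 1 ≤ d) {h : ℝ → ℂ} (hh : Continuous h) :
    IntervalIntegrable (fun x => h x * (((1 - x ^ 2) ^ ((d : ℝ) / 2 - 1) : ℝ) : ℂ)) volume (-1) 1 ∧
    ∫ x in (-1 : ℝ)..1, h x * (((1 - x ^ 2) ^ ((d : ℝ) / 2 - 1) : ℝ) : ℂ) =
      angularIntegral d fun θ => h (Real.cos θ) := by
  set g : ℝ → ℂ := fun x => h x * (((1 - x ^ 2) ^ ((d : ℝ) / 2 - 1) : ℝ) : ℂ)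
  have hderiv : ∀ θ ∈ Set.Ioo 0 Real.pi,
      HasDerivWithinAt Real.cos (-Real.sin θ) (Set.Ioo 0 Real.pi) θ :=
    fun θ _ => (Real.hasDerivAt_cos θ).hasDerivWithinAt
  have hinj : Set.InjOn Real.cos (Set.Ioo 0 Real.pi) :=
    Real.injOn_cos.mono Set.Ioo_subset_Icc_self
  -- The Jacobian `sin θ` raises the exponent `d - 2` to `d - 1`. The interval is open since for `d
  -- = 1` the equality can fail at the endpoints.
  have hcongr : Set.EqOn (fun θ => |-Real.sin θ| • g (Real.cos θ))
      (fun θ => h (Real.cos θ) * ((Real.sin θ ^ (d - 1) : ℝ) : ℂ)) (Set.Ioo 0 Real.pi) := by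
    intro θ hθ
    have hs : 0 < Real.sin θ := Real.sin_pos_of_mem_Ioo hθ
    have h2 : 1 - Real.cos θ ^ 2 = Real.sin θ ^ (2 : ℝ) := by
      rw [Real.rpow_two]; linarith [Real.sin_sq_add_cos_sq θ]
    have h3 : Real.sin θ * (1 - Real.cos θ ^ 2) ^ ((d : ℝ) / 2 - 1) = Real.sin θ ^ (d - 1) := by
      rw [h2, ← Real.rpow_mul hs.le, ← Real.rpow_natCast, Nat.cast_sub hd]
      nth_rewrite 1 [← Real.rpow_one (Real.sin θ)]
      rw [← Real.rpow_add hs]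
      congr 1
      push_cast; ring
    simp only [g]
    rw [abs_neg, abs_of_pos hs, Complex.real_smul, ← h3]
    push_cast; ring
  have hpi := Real.pi_pos.le
  constructor
  · rw [intervalIntegrable_iff_integrableOn_Ioo_of_le (by norm_num), ← cos_image_Ioo,
      integrableOn_image_iff_integrableOn_abs_deriv_smul measurableSet_Ioo hderiv hinj,
      integrableOn_congr_fun hcongr measurableSet_Ioo,
      ← intervalIntegrable_iff_integrableOn_Ioo_of_le hpi]
    exact intervalIntegrable_angular d (H := fun θ => h (Real.cos θ)) (by fun_prop)
  · rw [intervalIntegral.integral_of_le (by norm_num), integral_Ioc_eq_integral_Ioo,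
      ← cos_image_Ioo, integral_image_eq_integral_abs_deriv_smul measurableSet_Ioo hderiv hinj,
      setIntegral_congr_fun measurableSet_Ioo hcongr, angularIntegral,
      intervalIntegral.integral_of_le hpi, integral_Ioc_eq_integral_Ioo]

/-! ### Surface area constants -/

lemma sphereArea_add_two (k : ℕ) :
    sphereArea ((k + 2 : ℕ) : ℝ) * (k + 1) = sphereArea (k : ℝ) * (2 * Real.pi) := by
  have h1 : (((k + 2 : ℕ) : ℝ) + 1) / 2 = ((k : ℝ) + 1) / 2 + 1 := by push_cast; ring
  have hG := Real.Gamma_pos_of_pos (s := ((k : ℝ) + 1) / 2) (by positivity)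
  rw [sphereArea, sphereArea, h1, Real.Gamma_add_one (by positivity),
    Real.rpow_add_one Real.pi_ne_zero]
  field_simp

lemma sphereArea_pos (k : ℕ) : 0 < sphereArea (k : ℝ) := by
  have hG := Real.Gamma_pos_of_pos (s := ((k : ℝ) + 1) / 2) (by positivity)
  have := Real.pi_pos
  rw [sphereArea]; positivity

lemma sphereArea_zero : sphereArea ((0 : ℕ) : ℝ) = 2 := by
  have := Real.sqrt_pos.2 Real.pi_pos
  rw [sphereArea, Nat.cast_zero, zero_add, Real.Gamma_one_half_eq, ← Real.sqrt_eq_rpow]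
  field_simp

lemma sphereArea_one : sphereArea ((1 : ℕ) : ℝ) = 2 * Real.pi := by
  rw [sphereArea, Nat.cast_one]; norm_num

/-- Under `k → k + 2` both sides gain the factor `2π / (k + 2)`: by the functional equation of
Gamma, and by the reduction formula for `∫ sin^k`. -/
lemma sphereArea_succ (k : ℕ) : sphereArea ((k + 1 : ℕ) : ℝ) =
    sphereArea (k : ℝ) * ∫ θ in (0 : ℝ)..Real.pi, Real.sin θ ^ k := by
  induction k using Nat.twoStepInduction with
  | zero => rw [sphereArea_zero, sphereArea_one]; simp
  | one =>
    have h := sphereArea_add_two 0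
    rw [sphereArea_zero] at h
    rw [sphereArea_one]
    norm_num at h ⊢
    linarith
  | more k ih _ =>
    have h1 := sphereArea_add_two k
    have h2 := sphereArea_add_two (k + 1)
    have hk : ((k + 1 : ℕ) : ℝ) + 1 ≠ 0 := by positivity
    have hk1 : (k : ℝ) + 1 ≠ 0 := by positivity
    have hk2 : (k : ℝ) + 2 ≠ 0 := by positivity
    rw [integral_sin_pow]
    apply mul_right_cancel₀ hk
    rw [h2, ih]
    simp only [Real.sin_zero, Real.sin_pi, ne_eq, Nat.add_eq_zero_iff, one_ne_zero, and_false,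
      not_false_eq_true, zero_pow, zero_mul, sub_zero, zero_div, zero_add]
    push_cast at h1 ⊢
    field_simp
    linear_combination (-(k + 2 : ℝ) * ∫ θ in (0 : ℝ)..Real.pi, Real.sin θ ^ k) * h1

lemma harmonicDim_mul_sphereArea_div {d : ℕ} (hd : 1 ≤ d) (n : ℕ) :
    harmonicDim n d * sphereArea ((d : ℝ) - 1) / sphereArea d =
      harmonicDim n d / angularFunctional d 1 := by
  obtain ⟨d, rfl⟩ : ∃ k, d = k + 1 := ⟨d - 1, by omega⟩
  have h1 := sphereArea_pos d
  have h2 := angularFunctional_one_pos (d + 1)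
  have h3 : sphereArea ((d + 1 : ℕ) : ℝ) = sphereArea (d : ℝ) * angularFunctional (d + 1) 1 := by
    rw [angularFunctional_one, Nat.add_sub_cancel, sphereArea_succ]
  rw [h3, Nat.cast_add, Nat.cast_one, add_sub_cancel_right]
  field_simp

/-! ### Bounds from two-point matrices -/

/-- Every number in `[-1, 1]` is the inner product of two points of the sphere. -/
lemma exists_inner_eq {d : ℕ} (hd : 1 ≤ d) {x : ℝ} (hx : x ∈ Set.Icc (-1 : ℝ) 1) :
    ∃ ξ η : Metric.sphere (0 : EuclideanSpace ℝ (Fin (d + 1))) 1,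
      inner ℝ (ξ : EuclideanSpace ℝ (Fin (d + 1))) (η : EuclideanSpace ℝ (Fin (d + 1))) = x := by
  have hne : (1 : Fin (d + 1)) ≠ 0 := by
    rw [Ne, Fin.one_eq_zero_iff]; omega
  set a : EuclideanSpace ℝ (Fin (d + 1)) := EuclideanSpace.single 0 1
  set b : EuclideanSpace ℝ (Fin (d + 1)) := EuclideanSpace.single 1 1
  have ha : ‖a‖ = 1 := by simp [a]
  have hb : ‖b‖ = 1 := by simp [b]
  have hab : inner ℝ a b = (0 : ℝ) := by
    simp [a, b, EuclideanSpace.inner_single_left, hne.symm]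
  have h1 : 0 ≤ 1 - x ^ 2 := by nlinarith [hx.1, hx.2]
  refine ⟨⟨a, by simpa using ha⟩, ⟨x • a + Real.sqrt (1 - x ^ 2) • b, ?_⟩, ?_⟩
  · rw [mem_sphere_zero_iff_norm, ← sq_eq_sq₀ (norm_nonneg _) zero_le_one, norm_add_sq_real,
      norm_smul, norm_smul, inner_smul_left, inner_smul_right, hab, ha, hb]
    simp [Real.sq_sqrt h1]
  · simp [inner_add_right, inner_smul_right, hab, ha]

lemma finrank_euclideanSpace_succ (d : ℕ) :
    Module.finrank ℝ (EuclideanSpace ℝ (Fin (d + 1))) = d + 1 := by simp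

/-- Nonnegativity of the determinant. It yields both `|c_n| ≤ 1` on `[-1, 1]` and `|φ(u)| ≤ |φ(e)|`.
-/
lemma posSemidef_norm_le {M : Matrix (Fin 2) (Fin 2) ℂ} (hM : M.PosSemidef) (h : M 0 0 = M 1 1) :
    ‖M 0 1‖ ≤ ‖M 0 0‖ := by
  have h0 := hM.det_nonneg
  have h1 : M 1 0 = star (M 0 1) := (hM.isHermitian.apply 1 0).symm
  have h2 : star (M 0 0) = M 0 0 := hM.isHermitian.apply 0 0
  rw [Matrix.det_fin_two, ← h, h1] at h0
  have e1 : M 0 0 * M 0 0 = ((‖M 0 0‖ ^ 2 : ℝ) : ℂ) := by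
    nth_rewrite 1 [← h2]
    rw [Complex.star_def, Complex.conj_mul']; push_cast; rfl
  have e2 : M 0 1 * star (M 0 1) = ((‖M 0 1‖ ^ 2 : ℝ) : ℂ) := by
    rw [Complex.star_def, Complex.mul_conj']; push_cast; rfl
  rw [e1, e2, ← Complex.ofReal_sub, Complex.zero_le_real] at h0
  exact (sq_le_sq₀ (norm_nonneg _) (norm_nonneg _)).1 (by linarith)

lemma abs_gegPoly_le_one {d : ℕ} (hd : 1 ≤ d) (n : ℕ) {x : ℝ} (hx : x ∈ Set.Icc (-1 : ℝ) 1) :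
    |(gegPoly d n).eval x| ≤ 1 := by
  obtain ⟨ξ, η, rfl⟩ := exists_inner_eq hd hx
  have h := posSemidef_norm_le
    (gegPoly_posSemidef hd (finrank_euclideanSpace_succ d) n ![ξ, η])
  simpa [real_inner_self_eq_norm_sq, gegPoly_eval_one hd] using h

/-! ### Coefficients of Gegenbauer series and completeness -/

/-- The coefficients of a summable Gegenbauer expansion. -/
lemma angularIntegral_mul_gegPoly_of_hasSum {d : ℕ} (hd : 1 ≤ d) {a : ℕ → ℂ} {b : ℕ → ℝ}
    (hb : Summable b) (hab : ∀ n, ‖a n‖ ≤ b n) {H : ℝ → ℂ}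
    (hs : ∀ θ ∈ Set.Icc 0 Real.pi,
      HasSum (fun n => a n * (((gegPoly d n).eval (Real.cos θ) : ℝ) : ℂ)) (H θ)) (k : ℕ) :
    angularIntegral d (fun θ => H θ * (((gegPoly d k).eval (Real.cos θ) : ℝ) : ℂ)) =
      a k * ((angularFunctional d 1 / harmonicDim k d : ℝ) : ℂ) := by
  have hL := isGegFunctional_angularFunctional hd
  have key := intervalIntegral.hasSum_integral_of_dominated_convergence (μ := volume)
    (a := 0) (b := Real.pi)
    (F := fun n θ => a n * (((gegPoly d n).eval (Real.cos θ) : ℝ) : ℂ) *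
      (((gegPoly d k).eval (Real.cos θ) : ℝ) : ℂ) * ((Real.sin θ ^ (d - 1) : ℝ) : ℂ))
    (f := fun θ => H θ *
      (((gegPoly d k).eval (Real.cos θ) : ℝ) : ℂ) * ((Real.sin θ ^ (d - 1) : ℝ) : ℂ))
    (bound := fun n _ => b n)
    (fun n => (by fun_prop : Continuous _).aestronglyMeasurable) ?_ (.of_forall fun _ _ => hb)
    intervalIntegrable_const ?_
  · have e : ∀ n, ∫ θ in (0 : ℝ)..Real.pi, a n * (((gegPoly d n).eval (Real.cos θ) : ℝ) : ℂ) *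
        (((gegPoly d k).eval (Real.cos θ) : ℝ) : ℂ) * ((Real.sin θ ^ (d - 1) : ℝ) : ℂ) =
        a n * (angularFunctional d (gegPoly d n * gegPoly d k) : ℂ) := by
      intro n
      rw [← angularIntegral_poly, ← angularIntegral_const_mul, angularIntegral]
      simp only [eval_mul, Complex.ofReal_mul, mul_assoc]
    simp only [e] at key
    refine key.unique ?_
    have h2 : angularFunctional d 1 / harmonicDim k d =
        angularFunctional d (gegPoly d k * gegPoly d k) := by
      have := (harmonicDim_pos hd k).ne'
      rw [← hL.map_gegPoly_sq hd k]
      field_simp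
    rw [h2]
    refine hasSum_single k fun n hn => ?_
    rw [hL.map_gegPoly_mul_gegPoly hd hn]
    simp
  · intro n
    refine .of_forall fun θ _ => ?_
    rw [norm_mul, norm_mul, norm_mul, Complex.norm_real, Complex.norm_real, Complex.norm_real,
      Real.norm_eq_abs, Real.norm_eq_abs, norm_pow, Real.norm_eq_abs]
    have h1 := abs_gegPoly_le_one hd n (Real.cos_mem_Icc θ)
    have h2 := abs_gegPoly_le_one hd k (Real.cos_mem_Icc θ)
    have h3 : |Real.sin θ| ^ (d - 1) ≤ 1 := pow_le_one₀ (abs_nonneg _) (Real.abs_sin_le_one θ)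
    have h4 := (norm_nonneg (a n)).trans (hab n)
    calc _ ≤ b n * 1 * 1 * 1 := by gcongr; exact hab n
      _ = b n := by ring
  · refine .of_forall fun θ hθ => ?_
    rw [Set.uIoc_of_le Real.pi_pos.le] at hθ
    exact ((hs θ ⟨hθ.1.le, hθ.2⟩).mul_right _).mul_right _

/-- A continuous function on `[0, π]` that is orthogonal to all Gegenbauer polynomials vanishes. -/
lemma eq_zero_of_angularIntegral_mul_gegPoly {d : ℕ} (hd : 1 ≤ d) {H : ℝ → ℝ} (hH : Continuous H)
    (h0 : ∀ k, ∫ θ in (0 : ℝ)..Real.pi,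
      H θ * (gegPoly d k).eval (Real.cos θ) * Real.sin θ ^ (d - 1) = 0) :
    ∀ θ ∈ Set.Icc 0 Real.pi, H θ = 0 := by
  have hpoly : ∀ p : ℝ[X], ∫ θ in (0 : ℝ)..Real.pi,
      H θ * p.eval (Real.cos θ) * Real.sin θ ^ (d - 1) = 0 := by
    intro p
    rw [(isGegFunctional_angularFunctional hd).expansion hd (angularFunctional_one_pos d).ne'
      (le_refl p.natDegree)]
    simp only [eval_finsetSum, eval_smul, smul_eq_mul, Finset.mul_sum, Finset.sum_mul]
    rw [intervalIntegral.integral_finsetSum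
      fun i _ => Continuous.intervalIntegrable (by fun_prop) _ _]
    refine Finset.sum_eq_zero fun i _ => ?_
    have : ∀ θ (c : ℝ), H θ * (c * (gegPoly d i).eval (Real.cos θ)) * Real.sin θ ^ (d - 1) =
      c * (H θ * (gegPoly d i).eval (Real.cos θ) * Real.sin θ ^ (d - 1)) := fun θ c => by ring
    simp only [this]
    rw [intervalIntegral.integral_const_mul, h0, mul_zero]
  obtain ⟨C, hC⟩ : ∃ C, ∀ θ ∈ Set.Icc 0 Real.pi, ‖H θ‖ ≤ C :=
    isCompact_Icc.exists_bound_of_continuousOn hH.continuousOn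
  have hC0 : 0 ≤ C := (norm_nonneg _).trans (hC 0 ⟨le_rfl, Real.pi_pos.le⟩)
  have hsq : ∫ θ in (0 : ℝ)..Real.pi, H θ * H θ * Real.sin θ ^ (d - 1) ≤ 0 := by
    refine le_of_forall_pos_le_add fun ε hε => ?_
    rw [zero_add]
    -- Since `H` is orthogonal to `p(cos θ)`, one factor `H` may be replaced by `H - p(cos θ)`. The
    -- tolerance bounds the integrand by `ε / π`; `C + 1` keeps the denominator positive.
    obtain ⟨p, hp⟩ := exists_polynomial_near_of_continuousOn (-1) 1 (fun x => H (Real.arccos x))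
      (by fun_prop) (ε / ((C + 1) * Real.pi)) (by have := Real.pi_pos; positivity)
    calc ∫ θ in (0 : ℝ)..Real.pi, H θ * H θ * Real.sin θ ^ (d - 1)
        = ∫ θ in (0 : ℝ)..Real.pi, (H θ * H θ * Real.sin θ ^ (d - 1) -
            H θ * p.eval (Real.cos θ) * Real.sin θ ^ (d - 1)) := by
          rw [intervalIntegral.integral_sub (Continuous.intervalIntegrable (by fun_prop) _ _)
            (Continuous.intervalIntegrable (by fun_prop) _ _), hpoly, sub_zero]
      _ ≤ ∫ θ in (0 : ℝ)..Real.pi, ε / Real.pi := by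
          refine intervalIntegral.integral_mono_on Real.pi_pos.le
            (Continuous.intervalIntegrable (by fun_prop) _ _) intervalIntegrable_const
            fun θ hθ => (le_abs_self _).trans ?_
          have h1 := hp (Real.cos θ) (Real.cos_mem_Icc θ)
          rw [Real.arccos_cos hθ.1 hθ.2, abs_sub_comm] at h1
          have h2 : |H θ| ≤ C := hC θ hθ
          have h3 : |Real.sin θ| ^ (d - 1) ≤ 1 :=
            pow_le_one₀ (abs_nonneg _) (Real.abs_sin_le_one θ)
          have e : H θ * H θ * Real.sin θ ^ (d - 1) -
              H θ * p.eval (Real.cos θ) * Real.sin θ ^ (d - 1) =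
              H θ * (H θ - p.eval (Real.cos θ)) * Real.sin θ ^ (d - 1) := by ring
          rw [e, abs_mul, abs_mul, abs_pow]
          calc _ ≤ (C + 1) * (ε / ((C + 1) * Real.pi)) * 1 := by
                gcongr
                linarith
            _ = ε / Real.pi := by field_simp
      _ = ε := by
        rw [intervalIntegral.integral_const, sub_zero, smul_eq_mul]
        field_simp
  -- The weight may vanish at the endpoints, so these are reached by continuity.
  have hIoo : ∀ θ ∈ Set.Ioo 0 Real.pi, H θ = 0 := by
    intro θ hθ
    by_contra hne
    have hs : 0 < Real.sin θ := Real.sin_pos_of_mem_Ioo hθ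
    refine absurd hsq (not_le.2 ?_)
    refine intervalIntegral.integral_pos Real.pi_pos (by fun_prop) (fun t ht => ?_)
      ⟨θ, Set.Ioo_subset_Icc_self hθ, by have := mul_self_pos.2 hne; positivity⟩
    exact mul_nonneg (mul_self_nonneg _) (sin_pow_nonneg_of_mem ⟨ht.1.le, ht.2⟩ _)
  intro θ hθ
  rw [← closure_Ioo Real.pi_pos.ne] at hθ
  exact closure_minimal hIoo (isClosed_eq hH continuous_const) hθ

lemma eq_zero_of_angularIntegral_mul_gegPoly_complex {d : ℕ} (hd : 1 ≤ d) {H : ℝ → ℂ}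
    (hH : Continuous H)
    (h0 : ∀ k, angularIntegral d
      (fun θ => H θ * (((gegPoly d k).eval (Real.cos θ) : ℝ) : ℂ)) = 0) :
    ∀ θ ∈ Set.Icc 0 Real.pi, H θ = 0 := by
  have hsplit : ∀ k,
      (∫ θ in (0 : ℝ)..Real.pi,
        (H θ).re * (gegPoly d k).eval (Real.cos θ) * Real.sin θ ^ (d - 1) = 0) ∧
      (∫ θ in (0 : ℝ)..Real.pi,
        (H θ).im * (gegPoly d k).eval (Real.cos θ) * Real.sin θ ^ (d - 1) = 0) := by
    intro k
    have i2 := intervalIntegrable_angular d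
      (H := fun θ => H θ * (((gegPoly d k).eval (Real.cos θ) : ℝ) : ℂ)) (by fun_prop)
    have h := h0 k
    rw [angularIntegral, intervalIntegral.integral_of_le Real.pi_pos.le] at h
    have h1 := integral_re i2.1
    have h2 := integral_im i2.1
    rw [h] at h1 h2
    simp only [RCLike.re_to_complex, RCLike.im_to_complex, Complex.re_mul_ofReal,
      Complex.im_mul_ofReal, Complex.zero_re, Complex.zero_im] at h1 h2
    rw [intervalIntegral.integral_of_le Real.pi_pos.le,
      intervalIntegral.integral_of_le Real.pi_pos.le]
    exact ⟨h1, h2⟩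
  intro θ hθ
  apply Complex.ext
  · exact eq_zero_of_angularIntegral_mul_gegPoly hd (H := fun θ => (H θ).re) (by fun_prop)
      (fun k => (hsplit k).1) θ hθ
  · exact eq_zero_of_angularIntegral_mul_gegPoly hd (H := fun θ => (H θ).im) (by fun_prop)
      (fun k => (hsplit k).2) θ hθ

/-! ### The approximate identity `(1 + x)^m` and summability -/

/-- The Gegenbauer coefficients of the powers of `1 + x` are nonnegative. -/
lemma angularFunctional_one_add_X_pow_mul_nonneg {d : ℕ} (hd : 1 ≤ d) (m : ℕ) :
    ∀ j, 0 ≤ angularFunctional d ((1 + X) ^ m * gegPoly d j) := by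
  have hL := isGegFunctional_angularFunctional hd
  induction m with
  | zero =>
    rintro (_ | j)
    · simpa [gegPoly] using (angularFunctional_one_pos d).le
    · simp [hL.map_gegPoly hd j]
  | succ m ih =>
    intro j
    -- Nonnegativity survives multiplication by `1 + X` because `X c_j` is a nonnegative combination
    -- of neighbours.
    rw [pow_succ, mul_assoc, add_mul, one_mul, mul_add, map_add]
    refine add_nonneg (ih j) ?_
    rcases j with _ | j
    · simpa [gegPoly] using ih 1
    · rw [X_mul_gegPoly_succ hd, mul_add, mul_smul_comm, mul_smul_comm, map_add, map_smul,
        map_smul, smul_eq_mul, smul_eq_mul]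
      have h1 := ih (j + 2)
      have h2 := ih j
      positivity

lemma angularFunctional_one_add_X_pow_pos (d m : ℕ) :
    0 < angularFunctional d ((1 + X) ^ m) := by
  rw [angularFunctional_apply]
  refine intervalIntegral.integral_pos Real.pi_pos (by fun_prop) (fun t ht => ?_)
    ⟨Real.pi / 2, ⟨by positivity, by linarith [Real.pi_pos]⟩, by simp⟩
  refine mul_nonneg ?_ (sin_pow_nonneg_of_mem ⟨ht.1.le, ht.2⟩ _)
  simp only [eval_pow, eval_add, eval_one, eval_X]
  have := Real.neg_one_le_cos t
  exact pow_nonneg (by linarith) _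

/-- The normalized powers of `1 + x` form an approximate identity at `x = 1`. -/
lemma tendsto_angularFunctional_one_add_X_pow {d : ℕ} (hd : 1 ≤ d) (j : ℕ) :
    Tendsto (fun m => angularFunctional d ((1 + X) ^ m * gegPoly d j) /
      angularFunctional d ((1 + X) ^ m)) atTop (nhds 1) := by
  have hL := isGegFunctional_angularFunctional hd
  obtain ⟨q, hq⟩ : (X - C 1 : ℝ[X]) ∣ 1 - gegPoly d j := by
    rw [dvd_iff_isRoot]; simp [gegPoly_eval_one hd]
  obtain ⟨K, hK⟩ : ∃ K, ∀ x ∈ Set.Icc (-1 : ℝ) 1, ‖q.eval x‖ ≤ K :=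
    isCompact_Icc.exists_bound_of_continuousOn q.continuous.continuousOn
  have hK0 : 0 ≤ K := (norm_nonneg _).trans (hK 0 (by norm_num))
  have hbase : ∀ x ∈ Set.Icc (-1 : ℝ) 1, ∀ m : ℕ, 0 ≤ (1 + x) ^ m := fun x hx m =>
    pow_nonneg (by linarith [hx.1]) _
  -- The defining identity with `q = (1 + X)^m`: the normalized mean of `1 - x` is at most `d / m`.
  have h1 : ∀ m : ℕ, (m : ℝ) * angularFunctional d ((1 + X) ^ m * (1 - X)) ≤
      d * angularFunctional d ((1 + X) ^ m) := by
    intro m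
    have h := hL ((1 + X) ^ m)
    have e : (1 - X ^ 2) * derivative ((1 + X : ℝ[X]) ^ m) - (d : ℝ[X]) * (X * (1 + X) ^ m) =
        (m : ℝ) • ((1 + X) ^ m * (1 - X)) - (d : ℝ) • ((1 + X) ^ m * X) := by
      rcases m with _ | m
      · simp [smul_eq_C_mul]
      · rw [derivative_pow, Nat.add_sub_cancel]
        simp [smul_eq_C_mul]
        ring
    rw [e, map_sub, map_smul, map_smul, smul_eq_mul, smul_eq_mul, sub_eq_zero] at h
    rw [h]
    refine mul_le_mul_of_nonneg_left (angularFunctional_mono fun x hx => ?_) (Nat.cast_nonneg d)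
    simp only [eval_mul, eval_pow, eval_add, eval_one, eval_X]
    exact mul_le_of_le_one_right (hbase x hx m) hx.2
  -- As `1 - c_j` vanishes at `1`, it is at most `K (1 - x)`; the ratio therefore lies between `1 -
  -- K d / m` and `1`.
  have h2 : ∀ m : ℕ, angularFunctional d ((1 + X) ^ m * (1 - gegPoly d j)) ≤
      K * angularFunctional d ((1 + X) ^ m * (1 - X)) := by
    intro m
    rw [← smul_eq_mul K, ← map_smul]
    refine angularFunctional_mono fun x hx => ?_
    rw [hq]
    simp only [eval_mul, eval_pow, eval_add, eval_one, eval_X, eval_sub, eval_C, eval_smul,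
      smul_eq_mul]
    have h3 := (abs_le.1 (hK x hx)).1
    have h4 := mul_nonneg (hbase x hx m) (sub_nonneg.2 hx.2)
    nlinarith
  have h3 : ∀ m : ℕ, 0 ≤ angularFunctional d ((1 + X) ^ m * (1 - gegPoly d j)) := by
    intro m
    rw [← map_zero (angularFunctional d)]
    refine angularFunctional_mono fun x hx => ?_
    simp only [eval_zero, eval_mul, eval_pow, eval_add, eval_one, eval_X, eval_sub]
    have := (abs_le.1 (abs_gegPoly_le_one hd j hx)).2
    exact mul_nonneg (hbase x hx m) (by linarith)
  have e : ∀ m : ℕ, angularFunctional d ((1 + X) ^ m * gegPoly d j) =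
      angularFunctional d ((1 + X) ^ m) -
        angularFunctional d ((1 + X) ^ m * (1 - gegPoly d j)) := by
    intro m
    rw [← map_sub]; congr 1; ring
  have hlim : Tendsto (fun m : ℕ => 1 - K * d * (1 / (m : ℝ))) atTop (nhds 1) := by
    simpa using (tendsto_one_div_atTop_nhds_zero_nat (𝕜 := ℝ)).const_mul (K * d) |>.const_sub 1
  refine tendsto_of_tendsto_of_tendsto_of_le_of_le' hlim tendsto_const_nhds ?_
    (.of_forall fun m => ?_)
  · filter_upwards [eventually_gt_atTop 0] with m hm
    have hm' : (0 : ℝ) < m := by exact_mod_cast hm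
    rw [e, le_div_iff₀ (angularFunctional_one_add_X_pow_pos d m)]
    have := h1 m
    have h5 : angularFunctional d ((1 + X) ^ m * (1 - X)) ≤
        d * angularFunctional d ((1 + X) ^ m) * (1 / (m : ℝ)) := by
      rw [mul_one_div, le_div_iff₀ hm']; linarith
    have h6 := mul_le_mul_of_nonneg_left h5 hK0
    linarith [h2 m]
  · rw [div_le_one (angularFunctional_one_add_X_pow_pos d m), e]
    linarith [h3 m]

/-- Nonnegative Gegenbauer coefficients of a bounded function are summable. -/
lemma sum_gegenbauer_coeff_le {d : ℕ} (hd : 1 ≤ d) {H : ℝ → ℂ} (hH : Continuous H) {B : ℝ}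
    (hB : ∀ θ ∈ Set.Icc 0 Real.pi, ‖H θ‖ ≤ B) {a : ℕ → ℝ} (ha : ∀ n, 0 ≤ a n)
    (hcoef : ∀ n, (a n : ℂ) = ((harmonicDim n d / angularFunctional d 1 : ℝ) : ℂ) *
      angularIntegral d (fun θ => H θ * (((gegPoly d n).eval (Real.cos θ) : ℝ) : ℂ))) (M : ℕ) :
    ∑ n ∈ Finset.range M, a n ≤ B := by
  have hL := isGegFunctional_angularFunctional hd
  have hA := angularFunctional_one_pos d
  have hlim : Tendsto (fun m => ∑ n ∈ Finset.range M,
      angularFunctional d ((1 + X) ^ m * gegPoly d n) / angularFunctional d ((1 + X) ^ m) * a n)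
      atTop (nhds (∑ n ∈ Finset.range M, 1 * a n)) :=
    tendsto_finsetSum _ fun n _ => (tendsto_angularFunctional_one_add_X_pow hd n).mul_const _
  simp only [one_mul] at hlim
  refine le_of_tendsto hlim ?_
  filter_upwards [eventually_ge_atTop M] with m hm
  have hP := angularFunctional_one_add_X_pow_pos d m
  have hdeg : ((1 + X : ℝ[X]) ^ m).natDegree ≤ m := by
    refine natDegree_pow_le.trans ?_
    have : (1 + X : ℝ[X]).natDegree ≤ 1 := (natDegree_add_le _ _).trans (by simp)
    nlinarith
  -- For `m ≥ M` the remaining terms up to `n = m` are nonnegative and can be added. The full sum is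
  -- the mean of `H` against `(1 + x)^m`, hence at most `B`.
  calc ∑ n ∈ Finset.range M,
      angularFunctional d ((1 + X) ^ m * gegPoly d n) / angularFunctional d ((1 + X) ^ m) * a n
      ≤ ∑ n ∈ Finset.range (m + 1),
        angularFunctional d ((1 + X) ^ m * gegPoly d n) /
          angularFunctional d ((1 + X) ^ m) * a n := by
        refine Finset.sum_le_sum_of_subset_of_nonneg
          (Finset.range_subset_range.2 (by omega)) fun n _ _ => ?_
        exact mul_nonneg (div_nonneg (angularFunctional_one_add_X_pow_mul_nonneg hd m n) hP.le)
          (ha n)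
    _ = (∑ n ∈ Finset.range (m + 1),
        angularFunctional d ((1 + X) ^ m * gegPoly d n) * a n) /
          angularFunctional d ((1 + X) ^ m) := by
        rw [Finset.sum_div]
        exact Finset.sum_congr rfl fun n _ => by ring
    _ ≤ B := by
      rw [div_le_iff₀ hP]
      have e : ((∑ n ∈ Finset.range (m + 1),
          angularFunctional d ((1 + X) ^ m * gegPoly d n) * a n : ℝ) : ℂ) =
          angularIntegral d fun θ => H θ * ((((1 + X : ℝ[X]) ^ m).eval (Real.cos θ) : ℝ) : ℂ) := by
        conv_rhs => rw [hL.expansion hd hA.ne' hdeg]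
        simp only [eval_finsetSum, eval_smul, smul_eq_mul, Complex.ofReal_sum, Finset.mul_sum]
        rw [angularIntegral_finsetSum _ _ fun i _ => by fun_prop]
        refine Finset.sum_congr rfl fun n _ => ?_
        rw [Complex.ofReal_mul, hcoef, ← mul_assoc, ← Complex.ofReal_mul,
          ← angularIntegral_const_mul]
        congr 1; ext θ
        push_cast; ring
      refine (le_abs_self _).trans ?_
      rw [← Real.norm_eq_abs, ← Complex.norm_real, e, angularIntegral,
        angularFunctional_apply, ← intervalIntegral.integral_const_mul]
      refine intervalIntegral.norm_integral_le_of_norm_le Real.pi_pos.le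
        (.of_forall fun θ hθ => ?_) (Continuous.intervalIntegrable (by fun_prop) _ _)
      have hθ' : θ ∈ Set.Icc 0 Real.pi := ⟨hθ.1.le, hθ.2⟩
      have h0 : 0 ≤ ((1 + X : ℝ[X]) ^ m).eval (Real.cos θ) := by
        simp only [eval_pow, eval_add, eval_one, eval_X]
        exact pow_nonneg (by linarith [Real.neg_one_le_cos θ]) _
      rw [norm_mul, norm_mul, Complex.norm_real, Complex.norm_real, Real.norm_eq_abs,
        Real.norm_eq_abs, abs_of_nonneg h0, abs_of_nonneg (sin_pow_nonneg_of_mem hθ' _), mul_assoc]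
      exact mul_le_mul_of_nonneg_right (hB θ hθ')
        (mul_nonneg h0 (sin_pow_nonneg_of_mem hθ' _))

/-! ### Transfer to the sphere and closure properties of semidefinite matrices -/

lemma inner_sphere_mem_Icc {E : Type*} [NormedAddCommGroup E] [InnerProductSpace ℝ E]
    (ξ η : Metric.sphere (0 : E) 1) : inner ℝ (ξ : E) (η : E) ∈ Set.Icc (-1 : ℝ) 1 := by
  rw [Set.mem_Icc, ← abs_le]
  simpa using abs_real_inner_le_norm (ξ : E) (η : E)

lemma cos_sphereDist {d : ℕ} (ξ η : Metric.sphere (0 : EuclideanSpace ℝ (Fin (d + 1))) 1) :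
    Real.cos (sphereDist ξ η) =
      inner ℝ (ξ : EuclideanSpace ℝ (Fin (d + 1))) (η : EuclideanSpace ℝ (Fin (d + 1))) := by
  have := inner_sphere_mem_Icc ξ η
  rw [sphereDist, Real.cos_arccos this.1 this.2]

lemma sphereDist_mem_Icc {d : ℕ} (ξ η : Metric.sphere (0 : EuclideanSpace ℝ (Fin (d + 1))) 1) :
    sphereDist ξ η ∈ Set.Icc 0 Real.pi := ⟨Real.arccos_nonneg _, Real.arccos_le_pi _⟩

lemma projIcc_cos (θ : ℝ) : Set.projIcc (-1 : ℝ) 1 (by norm_num) (Real.cos θ) = cosIcc θ :=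
  Set.projIcc_of_mem _ _

lemma posSemidef_of_fintype {ι X : Type*} [Fintype ι] {K : X → X → ℂ}
    (h : ∀ (n : ℕ) (x : Fin n → X), (Matrix.of fun k l => K (x k) (x l)).PosSemidef) (x : ι → X) :
    (Matrix.of fun k l => K (x k) (x l)).PosSemidef := by
  have e := Fintype.equivFin ι
  have := (h _ (x ∘ e.symm)).submatrix e
  convert this using 1
  ext k l
  simp

lemma posSemidef_of_hasSum {ι : Type*} [Fintype ι] {M : ℕ → Matrix ι ι ℂ} {A : Matrix ι ι ℂ}
    (hM : ∀ n, (M n).PosSemidef) (h : ∀ k l, HasSum (fun n => M n k l) (A k l)) :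
    A.PosSemidef := by
  refine Matrix.PosSemidef.of_dotProduct_mulVec_nonneg ?_ fun z => ?_
  · ext k l
    have h1 := (h l k).star
    refine h1.unique ?_
    convert h k l using 2 with n
    exact (hM n).isHermitian.apply k l
  · have h1 : HasSum (fun n => star z ⬝ᵥ (M n).mulVec z) (star z ⬝ᵥ A.mulVec z) := by
      simp only [dotProduct, Matrix.mulVec]
      exact hasSum_sum fun k _ => (hasSum_sum fun l _ => (h k l).mul_right _).mul_left _
    exact h1.nonneg fun n => (hM n).dotProduct_mulVec_nonneg z

/-! ### Coefficient functions and the two implications -/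

section

variable {G : Type*}

/-- The candidate coefficient functions of an expansion in Gegenbauer polynomials. -/
def gegCoeff (d : ℕ) (f : Set.Icc (-1 : ℝ) 1 × G → ℂ) (n : ℕ) (u : G) : ℂ :=
  ((harmonicDim n d / angularFunctional d 1 : ℝ) : ℂ) *
    angularIntegral d fun θ => f (cosIcc θ, u) * (((gegPoly d n).eval (Real.cos θ) : ℝ) : ℂ)

lemma continuous_cosIcc : Continuous cosIcc := Real.continuous_cos.subtype_mk _

lemma star_angularIntegral (d : ℕ) (H : ℝ → ℂ) :
    star (angularIntegral d H) = angularIntegral d fun θ => star (H θ) := by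
  rw [angularIntegral, angularIntegral, intervalIntegral.integral_of_le Real.pi_pos.le,
    intervalIntegral.integral_of_le Real.pi_pos.le, Complex.star_def, ← integral_conj]
  simp only [map_mul, Complex.conj_ofReal]

variable [TopologicalSpace G] {d : ℕ} {f : Set.Icc (-1 : ℝ) 1 × G → ℂ}

/-- As `[-1, 1]` is compact, currying makes `v ↦ f(·, v)` continuous for the sup norm, which
controls the angular integral; no countability condition on `G` enters. -/
lemma continuous_gegCoeff (hf : Continuous f) (n : ℕ) : Continuous (gegCoeff d f n) := by
  refine continuous_const.mul ?_
  obtain ⟨C, hC⟩ : ∃ C, ∀ x ∈ Set.Icc (-1 : ℝ) 1, ‖(gegPoly d n).eval x‖ ≤ C :=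
    isCompact_Icc.exists_bound_of_continuousOn (gegPoly d n).continuous.continuousOn
  set F : C(G, C(Set.Icc (-1 : ℝ) 1, ℂ)) :=
    ContinuousMap.curry ⟨fun p : G × Set.Icc (-1 : ℝ) 1 => f (p.2, p.1), by fun_prop⟩
  have hcos := continuous_cosIcc
  rw [continuous_iff_continuousAt]
  intro u
  have hlim : Tendsto (fun v => ‖F v - F u‖ * C * angularFunctional d 1) (nhds u) (nhds 0) := by
    have : Continuous fun v => ‖F v - F u‖ * C * angularFunctional d 1 := by fun_prop
    simpa using this.tendsto u
  rw [ContinuousAt, tendsto_iff_norm_sub_tendsto_zero]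
  refine squeeze_zero (fun _ => norm_nonneg _) (fun v => ?_) hlim
  rw [← angularIntegral_sub d (by fun_prop) (by fun_prop)]
  refine norm_angularIntegral_le d fun θ _ => ?_
  rw [← sub_mul, norm_mul, Complex.norm_real]
  exact mul_le_mul ((F v - F u).norm_coe_le_norm (cosIcc θ)) (hC _ (Real.cos_mem_Icc θ))
    (norm_nonneg _) (norm_nonneg _)

lemma coefIntegrand_integral (hd : 1 ≤ d) (hf : Continuous f) (n : ℕ) (u : G) :
    IntervalIntegrable (coefIntegrand d f n u) volume (-1) 1 ∧
    ∫ x in (-1 : ℝ)..1, coefIntegrand d f n u x =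
      angularIntegral d fun θ =>
        f (cosIcc θ, u) * (((gegPoly d n).eval (Real.cos θ) : ℝ) : ℂ) := by
  have hproj : Continuous (Set.projIcc (-1 : ℝ) 1 (by norm_num)) := continuous_projIcc
  have := integral_weight_eq_angularIntegral hd
    (h := fun x => f (Set.projIcc (-1 : ℝ) 1 (by norm_num) x, u) *
      (((gegPoly d n).eval x : ℝ) : ℂ)) (by fun_prop)
  have e : coefIntegrand d f n u = fun x => f (Set.projIcc (-1 : ℝ) 1 (by norm_num) x, u) *
      (((gegPoly d n).eval x : ℝ) : ℂ) * (((1 - x ^ 2) ^ ((d : ℝ) / 2 - 1) : ℝ) : ℂ) := by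
    ext x
    rw [coefIntegrand, normGegenbauer_eq_gegPoly hd]
  rw [e]
  simpa only [projIcc_cos] using this

variable [Group G]

lemma PosDefFun.norm_le {φ : G → ℂ} (hφ : φ ∈ PosDefFun G) (u : G) : ‖φ u‖ ≤ ‖φ 1‖ := by
  have := posSemidef_norm_le (hφ.2 2 ![1, u]) (by simp)
  simpa using this

lemma PosDefFun.one_nonneg {φ : G → ℂ} (hφ : φ ∈ PosDefFun G) : 0 ≤ φ 1 := by
  have := (hφ.2 1 ![1]).diag_nonneg (i := 0)
  simpa using this

/-- Hermitian symmetry at the points `(ξ, e)`, `(η, v)` with `ξ · η = x`. -/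
lemma SpherePosDef.apply_inv (hd : 1 ≤ d) (hf : f ∈ SpherePosDef d G) (x : Set.Icc (-1 : ℝ) 1)
    (v : G) : f (x, v⁻¹) = star (f (x, v)) := by
  obtain ⟨ξ, η, h⟩ := exists_inner_eq hd x.2
  have e1 : cosIcc (sphereDist ξ η) = x := Subtype.ext (by rw [← h]; exact cos_sphereDist ξ η)
  have e2 : cosIcc (sphereDist η ξ) = x := Subtype.ext (by
    rw [← h, real_inner_comm]; exact cos_sphereDist η ξ)
  have := (hf.2 2 ![ξ, η] ![1, v]).isHermitian.apply 1 0
  simpa [e1, e2] using this.symm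

/-- By the Schur product, `f c_n` is positive definite on the sphere times `G`. Contracting the
group variable with `z` leaves a positive definite zonal kernel `F`, whose angular integral is
nonnegative. -/
lemma gegCoeff_mem_posDefFun (hd : 1 ≤ d) (hf : f ∈ SpherePosDef d G) (n : ℕ) :
    gegCoeff d f n ∈ PosDefFun G := by
  have hfc := hf.1
  have hcos := continuous_cosIcc
  refine ⟨continuous_gegCoeff hfc n, fun m u => ?_⟩
  have hκ : 0 < harmonicDim n d / angularFunctional d 1 :=
    div_pos (harmonicDim_pos hd n) (angularFunctional_one_pos d)
  have hker : ∀ (ι : Type) [Fintype ι]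
      (p : ι → Metric.sphere (0 : EuclideanSpace ℝ (Fin (d + 1))) 1 × G),
      (Matrix.of fun k l => f (cosIcc (sphereDist (p k).1 (p l).1), (p k).2⁻¹ * (p l).2) *
        (((gegPoly d n).eval (inner ℝ ((p k).1 : EuclideanSpace ℝ (Fin (d + 1)))
          ((p l).1 : EuclideanSpace ℝ (Fin (d + 1)))) : ℝ) : ℂ)).PosSemidef := by
    intro ι _ p
    have h1 := posSemidef_of_fintype (K := fun p q :
      Metric.sphere (0 : EuclideanSpace ℝ (Fin (d + 1))) 1 × G =>
        f (cosIcc (sphereDist p.1 q.1), p.2⁻¹ * q.2))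
      (fun n p => hf.2 n (fun k => (p k).1) fun k => (p k).2) p
    exact h1.hadamard (gegPoly_posSemidef hd (finrank_euclideanSpace_succ d) n fun k => (p k).1)
  refine Matrix.PosSemidef.of_dotProduct_mulVec_nonneg ?_ fun z => ?_
  · ext k l
    have e : ∀ x, f (x, (u k)⁻¹ * u l) = star (f (x, (u l)⁻¹ * u k)) := fun x => by
      rw [← SpherePosDef.apply_inv hd hf]; congr 2; group
    rw [Matrix.conjTranspose_apply, Matrix.of_apply, Matrix.of_apply, gegCoeff, gegCoeff,
      star_mul', star_angularIntegral]
    simp only [e, star_mul', Complex.star_def, Complex.conj_ofReal]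
  · set F : ℝ → ℂ := fun x => ∑ k, ∑ l, star (z k) * z l *
      (f (Set.projIcc (-1 : ℝ) 1 (by norm_num) x, (u k)⁻¹ * u l) *
        (((gegPoly d n).eval x : ℝ) : ℂ)) with hF
    have hproj : Continuous (Set.projIcc (-1 : ℝ) 1 (by norm_num)) := continuous_projIcc
    have hFc : Continuous F := by fun_prop
    have h0 := angularIntegral_nonneg (E := EuclideanSpace ℝ (Fin (d + 1))) hd
      (finrank_euclideanSpace_succ d) hFc fun t a => by
        -- Product points `(ξ, u_k)` with product coefficients `a(ξ) z_k` give the quadratic form of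
        -- `F` in the real weights `a`.
        have h1 := (hker (t × Fin m) fun p => (p.1, u p.2)).dotProduct_mulVec_nonneg
          fun p => a p.1 * z p.2
        refine h1.trans_eq ?_
        simp only [dotProduct, Matrix.mulVec, Fintype.sum_prod_type, hF, Finset.mul_sum,
          Matrix.of_apply, Pi.star_apply]
        rw [← Finset.sum_coe_sort t]
        refine Finset.sum_congr rfl fun ξ _ => ?_
        rw [← Finset.sum_coe_sort t, Finset.sum_comm]
        refine Finset.sum_congr rfl fun η _ => Finset.sum_congr rfl fun k _ =>
          Finset.sum_congr rfl fun l _ => ?_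
        rw [← cos_sphereDist, projIcc_cos, star_mul', Complex.star_def, Complex.conj_ofReal]
        ring
    have e : angularIntegral d (fun θ => F (Real.cos θ)) = ∑ k, ∑ l, star (z k) * z l *
        angularIntegral d fun θ => f (cosIcc θ, (u k)⁻¹ * u l) *
          (((gegPoly d n).eval (Real.cos θ) : ℝ) : ℂ) := by
      simp only [hF, projIcc_cos]
      rw [angularIntegral_finsetSum _ _ fun k _ => by fun_prop]
      refine Finset.sum_congr rfl fun k _ => ?_
      rw [angularIntegral_finsetSum _ _ fun l _ => by fun_prop]
      exact Finset.sum_congr rfl fun l _ => angularIntegral_const_mul _ _ _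
    rw [e] at h0
    have h2 := mul_nonneg (Complex.zero_le_real.2 hκ.le) h0
    refine h2.trans_eq ?_
    simp only [dotProduct, Matrix.mulVec, Finset.mul_sum, Matrix.of_apply, Pi.star_apply, gegCoeff]
    refine Finset.sum_congr rfl fun k _ => Finset.sum_congr rfl fun l _ => by ring

/-- The Gegenbauer coefficients of a positive definite function are a Schoenberg sequence. -/
lemma gegCoeff_isSchoenbergSequence (hd : 1 ≤ d) (hf : f ∈ SpherePosDef d G) :
    IsSchoenbergSequence d f (gegCoeff d f) := by
  have hfc := hf.1
  have hcos := continuous_cosIcc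
  have hpd := gegCoeff_mem_posDefFun hd hf
  have hre : ∀ n, ((‖gegCoeff d f n 1‖ : ℝ) : ℂ) = gegCoeff d f n 1 := fun n =>
    (Complex.eq_coe_norm_of_nonneg (PosDefFun.one_nonneg (hpd n))).symm
  have hsum : Summable fun n => ‖gegCoeff d f n 1‖ := by
    have hH : Continuous fun θ => f (cosIcc θ, (1 : G)) := by fun_prop
    obtain ⟨B, hB⟩ : ∃ B, ∀ θ ∈ Set.Icc 0 Real.pi, ‖f (cosIcc θ, (1 : G))‖ ≤ B :=
      isCompact_Icc.exists_bound_of_continuousOn hH.continuousOn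
    refine summable_of_sum_range_le (c := B) (fun n => norm_nonneg _) fun M =>
      sum_gegenbauer_coeff_le hd hH hB (fun n => norm_nonneg _) (fun n => ?_) M
    rw [hre]; rfl
  refine ⟨hpd, .of_norm hsum, fun θ hθ u => ?_⟩
  simp only [normGegenbauer_eq_gegPoly hd]
  have hle : ∀ n θ, ‖gegCoeff d f n u * (((gegPoly d n).eval (Real.cos θ) : ℝ) : ℂ)‖ ≤
      ‖gegCoeff d f n 1‖ := by
    intro n θ
    rw [norm_mul, Complex.norm_real]
    exact (mul_le_of_le_one_right (norm_nonneg _)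
      (abs_gegPoly_le_one hd n (Real.cos_mem_Icc θ))).trans (PosDefFun.norm_le (hpd n) u)
  have hsummable : ∀ θ, Summable fun n =>
      gegCoeff d f n u * (((gegPoly d n).eval (Real.cos θ) : ℝ) : ℂ) := fun θ =>
    .of_norm_bounded hsum fun n => hle n θ
  set S : ℝ → ℂ := fun θ => ∑' n, gegCoeff d f n u * (((gegPoly d n).eval (Real.cos θ) : ℝ) : ℂ)
  have hS : Continuous S := continuous_tsum (fun n => by fun_prop) hsum hle
  -- `f(·, u)` and the sum of its series are continuous with equal coefficients, so completeness
  -- identifies them.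
  have hzero := eq_zero_of_angularIntegral_mul_gegPoly_complex hd
    (H := fun θ => f (cosIcc θ, u) - S θ) (by fun_prop) fun k => by
      have h1 := angularIntegral_mul_gegPoly_of_hasSum hd hsum
        (fun n => PosDefFun.norm_le (hpd n) u) (H := S) (fun θ _ => (hsummable θ).hasSum) k
      simp only [sub_mul]
      rw [angularIntegral_sub d (by fun_prop) (by fun_prop), h1, gegCoeff]
      have h2 := (harmonicDim_pos hd k).ne'
      have h3 := (angularFunctional_one_pos d).ne'
      have h4 : ((harmonicDim k d / angularFunctional d 1 : ℝ) : ℂ) *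
          ((angularFunctional d 1 / harmonicDim k d : ℝ) : ℂ) = 1 := by
        rw [← Complex.ofReal_mul]
        norm_cast
        field_simp
      linear_combination (-(angularIntegral d fun θ =>
        f (cosIcc θ, u) * (((gegPoly d k).eval (Real.cos θ) : ℝ) : ℂ))) * h4
  rw [sub_eq_zero.1 (hzero θ hθ)]
  exact (hsummable θ).hasSum

/-- Each term is a Schur product of positive semidefinite matrices, and entrywise sums preserve
semidefiniteness. -/
lemma IsSchoenbergSequence.mem_spherePosDef (hd : 1 ≤ d) (hf : Continuous f) {φ : ℕ → G → ℂ}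
    (h : IsSchoenbergSequence d f φ) : f ∈ SpherePosDef d G := by
  refine ⟨hf, fun m ξ u => ?_⟩
  refine posSemidef_of_hasSum (M := fun n => Matrix.hadamard
    (Matrix.of fun k l : Fin m => φ n ((u k)⁻¹ * u l))
    (Matrix.of fun k l : Fin m => (((gegPoly d n).eval
      (inner ℝ (ξ k : EuclideanSpace ℝ (Fin (d + 1)))
        (ξ l : EuclideanSpace ℝ (Fin (d + 1)))) : ℝ) : ℂ)))
    (fun n => ((h.1 n).2 m u).hadamard
      (gegPoly_posSemidef hd (finrank_euclideanSpace_succ d) n ξ)) fun k l => ?_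
  have := h.2.2 (sphereDist (ξ k) (ξ l)) (sphereDist_mem_Icc _ _) ((u k)⁻¹ * u l)
  simpa only [normGegenbauer_eq_gegPoly hd, cos_sphereDist, Matrix.hadamard_apply,
    Matrix.of_apply] using this

/-- Weierstrass test with majorant `|φ_n(e)|`. -/
lemma IsSchoenbergSequence.tendstoUniformlyOn (hd : 1 ≤ d) {φ : ℕ → G → ℂ}
    (h : IsSchoenbergSequence d f φ) :
    TendstoUniformlyOn
      (fun (N : ℕ) (p : ℝ × G) =>
        ∑ n ∈ Finset.range N, φ n p.2 * (normGegenbauer n d (Real.cos p.1) : ℂ))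
      (fun p : ℝ × G => f (cosIcc p.1, p.2)) atTop (Set.Icc 0 Real.pi ×ˢ Set.univ) := by
  have hu := tendstoUniformlyOn_tsum_nat (s := Set.Icc 0 Real.pi ×ˢ (Set.univ : Set G))
    (f := fun n (p : ℝ × G) => φ n p.2 * (normGegenbauer n d (Real.cos p.1) : ℂ)) h.2.1.norm
    fun n p _ => by
      rw [normGegenbauer_eq_gegPoly hd, norm_mul, Complex.norm_real]
      exact (mul_le_of_le_one_right (norm_nonneg _)
        (abs_gegPoly_le_one hd n (Real.cos_mem_Icc _))).trans (PosDefFun.norm_le (h.1 n) _)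
  exact hu.congr_right fun p hp => (h.2.2 p.1 hp.1 p.2).tsum_eq

/-- Termwise integration against `c_n` and orthogonality; in particular the expansion is unique. -/
lemma IsSchoenbergSequence.eq_gegCoeff (hd : 1 ≤ d) {φ : ℕ → G → ℂ}
    (h : IsSchoenbergSequence d f φ) (n : ℕ) (u : G) : φ n u = gegCoeff d f n u := by
  have h1 := angularIntegral_mul_gegPoly_of_hasSum hd (a := fun n => φ n u) h.2.1.norm
    (fun n => PosDefFun.norm_le (h.1 n) u) (H := fun θ => f (cosIcc θ, u)) (fun θ hθ => by
      simpa only [normGegenbauer_eq_gegPoly hd] using h.2.2 θ hθ u) n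
  have h2 := (harmonicDim_pos hd n).ne'
  have h3 := (angularFunctional_one_pos d).ne'
  rw [gegCoeff, h1, mul_left_comm, ← Complex.ofReal_mul]
  field_simp
  simp

end

end

theorem theorem3p3 {G : Type*} [Group G] [TopologicalSpace G] [IsTopologicalGroup G]
    [LocallyCompactSpace G] (d : ℕ) (hd : 1 ≤ d)
    (f : Set.Icc (-1 : ℝ) 1 × G → ℂ) (hf : Continuous f) :
    (f ∈ SpherePosDef d G ↔ ∃ φ : ℕ → G → ℂ, IsSchoenbergSequence d f φ) ∧
    ∀ φ : ℕ → G → ℂ, IsSchoenbergSequence d f φ →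
      TendstoUniformlyOn
        (fun (N : ℕ) (p : ℝ × G) =>
          ∑ n ∈ Finset.range N, φ n p.2 * (normGegenbauer n d (Real.cos p.1) : ℂ))
        (fun p : ℝ × G => f (cosIcc p.1, p.2)) Filter.atTop
        (Set.Icc 0 Real.pi ×ˢ Set.univ) ∧
      ∀ (n : ℕ) (u : G),
        IntervalIntegrable (coefIntegrand d f n u) MeasureTheory.volume (-1) 1 ∧
        φ n u = ((harmonicDim n d * sphereArea ((d : ℝ) - 1) / sphereArea d : ℝ) : ℂ) *
          ∫ x in (-1 : ℝ)..1, coefIntegrand d f n u x := by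
  refine ⟨⟨fun h => ⟨_, gegCoeff_isSchoenbergSequence hd h⟩,
    fun ⟨φ, h⟩ => h.mem_spherePosDef hd hf⟩, fun φ h => ⟨h.tendstoUniformlyOn hd, fun n u => ?_⟩⟩
  obtain ⟨h1, h2⟩ := coefIntegrand_integral hd hf n u
  refine ⟨h1, ?_⟩
  rw [h2, harmonicDim_mul_sphereArea_div hd, h.eq_gegCoeff hd n u, gegCoeff]
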